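/- **Conventions.** All graphs are finite, simple and undirected. A colored graph is a vertex-colored graph $G$ (the coloring $\mathrm{col}_G$ need not be proper); colors are bit strings (more precisely, codes of finite data objects), linearly ordered lexicographically; isomorphisms preserve colors. Let $\mathcal{C}$ be a hereditary class of graphs (closed under isomorphism and under induced subgraphs). A colored graph is in $\mathcal{C}$ if its underlying graph is; an uncolored graph is regarded as a graph with one color. A *complete invariant* for the colored graphs in $\mathcal{C}$ is a map $I$ to the colors such that $I(G)=I(H)$ if and only if $G\cong H$, for all colored graphs $G,H$ in $\mathcal{C}$. **Modules.** A set $M\subseteq V(G)$ is a *colored module* of a colored graph $G$ if every $v\in V(G)\setminus M$ is adjacent to both or neither of $x,x'$ whenever $x,x'\in M$ have the same color. It is *non-trivial* if there are distinct $x,y\in M$ such that every $v\in V(G)\setminus M$ is adjacent to both or neither of $x,y$. The *adjacency type* of $v\in M$ is its set of neighbors outside $M$. A *decomposition functor* $D$ for $\mathcal{C}$ assigns to every colored graph $G$ in $\mathcal{C}$ a partition $D(G)$ of a subset of $V(G)$ into (non-empty) colored modules such that $D(G')=\{\phi(M)\mid M\in D(G)\}$ for every isomorphism $\phi\colon G\to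 G'$. We require that every non-trivial $M\in D(G)$ is a proper subset of $V(G)$. The graph $G$ is *prime* if $D(G)$ contains no non-trivial module. For $v\in V(G)$ let $M_v$ be the element of $D(G)$ containing $v$, or $\{v\}$ if there is none. **Quotients.** A *replacement operator* $R$ assigns to every colored graph $G$ in $\mathcal{C}$ and every non-trivial $M\in D(G)$ an induced subgraph of $G[M]$ with possibly new colors that contains at least one vertex of each adjacency type occurring in $M$; for every isomorphism $\phi\colon G\to G'$ the colored graphs assigned to $(G,M)$ and $(G',\phi(M))$ are isomorphic. Given a complete invariant $I$, the *quotient graph* $Q_I(G)$ is obtained from $G$ by simultaneously replacing all non-trivial modules in $D(G)$ by means of $R$ (each replaced module is cut down to the vertices that $R$ retains; adjacencies are those of $G$) and then coloring every remaining vertex $v$ with the triple $(\chi(v),L(v),I(G[M_v]))$, where $\chi(v)$ is the color of $v$ after the replacement and $L(v)$ is the sorted list of the colors $\mathrm{col}_G(w)$ of the vertices $w\in M_v$ of the same adjacency type as $v$. The functor $D$ is *simple* with respect to $R$ if $Q_I(G)$ is prime for every complete invariant $I$ and every colored graph $G$ in $\mathcal{C}$. The operator $R$ is *reversible* if for every complete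 invariant $I$ and all colored graphs $G_1,G_2$ in $\mathcal{C}$ we have $G_1\cong G_2$ if and only if $Q_I(G_1)\cong Q_I(G_2)$. **Theorem.** Let $\mathcal{C}$ be a hereditary graph class, let $D$ be a polynomial-time computable decomposition functor for $\mathcal{C}$ in which all non-trivial modules are proper subsets of the vertex set, and let $R$ be a polynomial-time computable, reversible replacement operator with respect to which $D$ is simple. If the isomorphism problem for colored graphs in $\mathcal{C}$ that are prime with respect to $D$ can be solved in polynomial time, then the isomorphism problem for all colored graphs in $\mathcal{C}$ can be solved in polynomial time. (Algorithms are only required to be correct and polynomial-time on inputs of the stated kind.) -/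

import Mathlib

/-! ### Data values and a machine model with a step count -/

/-- Data values: binary trees, on which programs compute. Vertex colors are data values, too. -/
inductive TreeData : Type where
  | nil : TreeData
  | node : TreeData → TreeData → TreeData

namespace TreeData

/-- The number of nodes and leaves. -/
def size : TreeData → ℕ
  | nil => 1
  | node a b => 1 + a.size + b.size

/-- The bit string of a data value (preorder traversal). -/
def bits : TreeData → List Bool
  | nil => [false]
  | node a b => true :: (a.bits ++ b.bits)

theorem bits_append_inj : ∀ (a b : TreeData) (l m : List Bool),
    a.bits ++ l = b.bits ++ m → a = b ∧ l = m
  | nil, nil, l, m, h => by simpa [bits] using h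
  | nil, node c d, l, m, h => by simp [bits] at h
  | node a b, nil, l, m, h => by simp [bits] at h
  | node a b, node c d, l, m, h => by
      simp only [bits, List.cons_append, List.append_assoc, List.cons.injEq, true_and] at h
      obtain ⟨h1, h2⟩ := bits_append_inj a c _ _ h
      obtain ⟨h3, h4⟩ := bits_append_inj b d _ _ h2
      exact ⟨by rw [h1, h3], h4⟩

theorem bits_injective : Function.Injective bits := fun a b h =>
  (bits_append_inj a b [] [] (by rw [h])).1

/-- The linear order on data values (hence on colors): lexicographic comparison of bit strings. -/
noncomputable instance : LinearOrder TreeData := LinearOrder.lift' bits bits_injective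

/-- The left child (`nil` for a leaf). -/
def left : TreeData → TreeData
  | nil => nil
  | node a _ => a

/-- The right child (`nil` for a leaf). -/
def right : TreeData → TreeData
  | nil => nil
  | node _ b => b

/-- A list of data values as one data value. -/
def ofList : List TreeData → TreeData
  | [] => nil
  | a :: l => node a (ofList l)

/-- A vector of data values as one data value. -/
def ofVector {n : ℕ} (f : Fin n → TreeData) : TreeData := ofList (List.ofFn f)

open Classical in
/-- A truth value as a data value: `nil` is false and `node nil nil` is true. -/
noncomputable def ofProp (p : Prop) : TreeData := if p then node nil nil else nil

/-- The Boolean matrix of a binary relation on `{0, ..., n - 1}` as a data value. -/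
noncomputable def ofRel {n : ℕ} (r : Fin n → Fin n → Prop) : TreeData :=
  ofVector fun i => ofVector fun j => ofProp (r i j)

end TreeData

/-- Programs of the WHILE language on binary trees. -/
inductive WhileProg : Type where
  | id : WhileProg
  | nil : WhileProg
  | left : WhileProg
  | right : WhileProg
  | node : WhileProg → WhileProg → WhileProg
  | comp : WhileProg → WhileProg → WhileProg
  | ite : WhileProg → WhileProg → WhileProg → WhileProg
  | loop : WhileProg → WhileProg → WhileProg

/-- `WhileProg.Eval p x y t`: on input `x` the program `p` halts with output `y` at cost `t`.

Every elementary operation is charged the full size of the value it reads (nothing is copied, read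
or discarded for free), so the size of the input and that of the output are at most the cost. Hence
a Turing machine simulates a run with polynomial overhead, and conversely, and polynomial time in
this model is polynomial time on Turing machines.

`comp g f` is `f` followed by `g`; `ite c f g` runs `f` if `c` answers with a tree that is not `nil`
and `g` otherwise; `loop c f` is `while c x ≠ nil do x := f x`. -/
inductive WhileProg.Eval : WhileProg → TreeData → TreeData → ℕ → Prop where
  | id (x : TreeData) : Eval .id x x x.size
  | nil (x : TreeData) : Eval .nil x .nil x.size
  | left (x : TreeData) : Eval .left x x.left x.size
  | right (x : TreeData) : Eval .right x x.right x.size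
  | node {f g : WhileProg} {x a b : TreeData} {s t : ℕ} :
      Eval f x a s → Eval g x b t → Eval (.node f g) x (.node a b) (s + t + 1)
  | comp {f g : WhileProg} {x y z : TreeData} {s t : ℕ} :
      Eval f x y s → Eval g y z t → Eval (.comp g f) x z (s + t + 1)
  | ite_true {c f g : WhileProg} {x a b y : TreeData} {s t : ℕ} :
      Eval c x (.node a b) s → Eval f x y t → Eval (.ite c f g) x y (s + t + 1)
  | ite_false {c f g : WhileProg} {x y : TreeData} {s t : ℕ} :
      Eval c x .nil s → Eval g x y t → Eval (.ite c f g) x y (s + t + 1)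
  | loop_done {c f : WhileProg} {x : TreeData} {s : ℕ} :
      Eval c x .nil s → Eval (.loop c f) x x (s + x.size + 1)
  | loop_step {c f : WhileProg} {x a b y z : TreeData} {s t u : ℕ} :
      Eval c x (.node a b) s → Eval f x y t → Eval (.loop c f) y z u →
      Eval (.loop c f) x z (s + t + u + 1)

/-- For a family of problem instances `i`, the solution `out i` is computed from the input `inp i`
by one program within a number of steps that is polynomial in the size of the input. (Nothing is
required of the program on data values that are not inputs.) -/
def ComputableInPolyTime {ι : Type*} (inp out : ι → TreeData) : Prop :=
  ∃ (p : WhileProg) (q : Polynomial ℕ),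
    ∀ i, ∃ t, t ≤ q.eval (inp i).size ∧ p.Eval (inp i) (out i) t

/-! ### Colored graphs -/

/-- A finite simple undirected graph with a (not necessarily proper) vertex coloring. -/
structure ColoredGraph : Type 1 where
  V : Type
  [finite : Finite V]
  graph : SimpleGraph V
  color : V → TreeData

attribute [instance] ColoredGraph.finite

/-- An isomorphism of colored graphs maps each vertex to a vertex of the same color. -/
structure ColoredGraph.Iso (G H : ColoredGraph) where
  toIso : G.graph ≃g H.graph
  map_color : ∀ v, H.color (toIso v) = G.color v

/-- The two colored graphs are isomorphic. -/
def ColoredGraph.Isomorphic (G H : ColoredGraph) : Prop := Nonempty (G.Iso H)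

/-- The colored subgraph induced by a set of vertices. -/
def ColoredGraph.induce (G : ColoredGraph) (S : Set G.V) : ColoredGraph where
  V := S
  graph := G.graph.induce S
  color := fun v => G.color v

/-- A class of finite graphs. A colored graph belongs to it if its underlying graph does. -/
abbrev GraphClass := ∀ V : Type, SimpleGraph V → Prop

/-- `G` is a colored graph in the class `C`. -/
def ColoredGraph.InClass (G : ColoredGraph) (C : GraphClass) : Prop := C G.V G.graph

/-- The class is closed under (isomorphic copies of) induced subgraphs. -/
def GraphClass.Hereditary (C : GraphClass) : Prop :=
  ∀ (V W : Type) [Finite V] [Finite W] (G : SimpleGraph V) (H : SimpleGraph W),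
    Nonempty (G ↪g H) → C W H → C V G

/-- A complete invariant for the colored graphs in `C`. -/
def IsCompleteInvariant (C : GraphClass) (I : ColoredGraph → TreeData) : Prop :=
  ∀ G H : ColoredGraph, G.InClass C → H.InClass C → (I G = I H ↔ G.Isomorphic H)

/-- A colored graph with vertex set `{0, ..., n - 1}`: the form in which graphs are given to
programs. -/
structure FinColoredGraph where
  n : ℕ
  graph : SimpleGraph (Fin n)
  color : Fin n → TreeData

/-- The colored graph itself. -/
abbrev FinColoredGraph.toColoredGraph (G : FinColoredGraph) : ColoredGraph where
  V := Fin G.n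
  graph := G.graph
  color := G.color

/-- The encoding of a colored graph: its adjacency matrix and the vector of its colors. -/
noncomputable def FinColoredGraph.encode (G : FinColoredGraph) : TreeData :=
  .node (.ofRel G.graph.Adj) (.ofVector G.color)

/-- The isomorphism problem for the colored graphs with property `P` (given two of them, decide
whether they are isomorphic) can be solved in polynomial time. -/
def IsomorphismInPolyTime (P : ColoredGraph → Prop) : Prop :=
  ComputableInPolyTime
    (ι := {x : FinColoredGraph × FinColoredGraph //
      P x.1.toColoredGraph ∧ P x.2.toColoredGraph})
    (fun x => .node x.1.1.encode x.1.2.encode)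
    (fun x => .ofProp (x.1.1.toColoredGraph.Isomorphic x.1.2.toColoredGraph))

/-! ### Colored modules and decomposition functors -/

/-- `M` is a colored module: no vertex outside of `M` distinguishes vertices of `M` of the same
color. -/
def ColoredGraph.IsModule (G : ColoredGraph) (M : Set G.V) : Prop :=
  ∀ v, v ∉ M → ∀ x ∈ M, ∀ y ∈ M, G.color x = G.color y → (G.graph.Adj v x ↔ G.graph.Adj v y)

/-- `M` contains two vertices that no vertex outside of `M` distinguishes. -/
def ColoredGraph.Nontrivial (G : ColoredGraph) (M : Set G.V) : Prop :=
  ∃ x ∈ M, ∃ y ∈ M, x ≠ y ∧ ∀ v, v ∉ M → (G.graph.Adj v x ↔ G.graph.Adj v y)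

/-- The adjacency type of a vertex `v` of `M`: its neighbors outside of `M`. -/
def ColoredGraph.adjType (G : ColoredGraph) (M : Set G.V) (v : G.V) : Set G.V :=
  {w | w ∉ M ∧ G.graph.Adj v w}

/-- A decomposition functor for the colored graphs in `C`: an isomorphism invariant assignment of a
partition of a subset of the vertices into colored modules. -/
structure DecompositionFunctor (C : GraphClass) where
  modules : (G : ColoredGraph) → Set (Set G.V)
  nonempty : ∀ G : ColoredGraph, G.InClass C → ∀ M ∈ modules G, M.Nonempty
  pairwiseDisjoint : ∀ G : ColoredGraph, G.InClass C → (modules G).PairwiseDisjoint id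
  isModule : ∀ G : ColoredGraph, G.InClass C → ∀ M ∈ modules G, G.IsModule M
  invariant : ∀ G H : ColoredGraph, G.InClass C → H.InClass C → ∀ e : G.Iso H,
    modules H = (fun M => e.toIso '' M) '' modules G

namespace DecompositionFunctor

variable {C : GraphClass} (D : DecompositionFunctor C)

/-- `G` is prime: the decomposition of `G` contains no non-trivial module. -/
def Prime (G : ColoredGraph) : Prop := ∀ M ∈ D.modules G, ¬ G.Nontrivial M

/-- The non-trivial modules of a decomposition are proper subsets of the vertex set. -/
def Proper : Prop :=
  ∀ G : ColoredGraph, G.InClass C → ∀ M ∈ D.modules G, G.Nontrivial M → M ≠ Set.univ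

/-- The functor is polynomial-time computable. A decomposition is output as the Boolean matrix of
the relation of lying in a common module. -/
def PolyTime : Prop :=
  ComputableInPolyTime
    (ι := {G : FinColoredGraph // G.toColoredGraph.InClass C})
    (fun G => G.1.encode)
    (fun G => .ofRel (n := G.1.n) fun v w =>
      ∃ M ∈ D.modules G.1.toColoredGraph, v ∈ M ∧ w ∈ M)

/-- The module that contains `v`. A vertex in none of the modules counts as a one-element module. -/
def block (G : ColoredGraph) (v : G.V) : Set G.V :=
  {w | w = v ∨ ∃ M ∈ D.modules G, v ∈ M ∧ w ∈ M}

end DecompositionFunctor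

/-! ### Replacement operators and quotient graphs -/

/-- The induced subgraph on `S` with new colors `c`. -/
def ColoredGraph.induceRecolored (G : ColoredGraph) (S : Set G.V) (c : G.V → TreeData) :
    ColoredGraph where
  V := S
  graph := G.graph.induce S
  color := fun v => c v

/-- A replacement operator: to each non-trivial module `M` in the decomposition of a graph `G` it
assigns the subgraph of `M` induced by `keep G M`, with the new colors `recolor G M`. At least one
vertex of each adjacency type is maintained. Up to isomorphism, the replacement depends only on the
isomorphism type of the graph with the module. -/
structure ReplacementOperator {C : GraphClass} (D : DecompositionFunctor C) where
  keep : (G : ColoredGraph) → Set G.V → Set G.V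
  recolor : (G : ColoredGraph) → Set G.V → G.V → TreeData
  keep_subset : ∀ G : ColoredGraph, G.InClass C → ∀ M ∈ D.modules G, G.Nontrivial M →
    keep G M ⊆ M
  maintains : ∀ G : ColoredGraph, G.InClass C → ∀ M ∈ D.modules G, G.Nontrivial M →
    ∀ x ∈ M, ∃ y ∈ keep G M, G.adjType M y = G.adjType M x
  invariant : ∀ G H : ColoredGraph, G.InClass C → H.InClass C →
    ∀ M ∈ D.modules G, G.Nontrivial M → ∀ e : G.Iso H,
      (G.induceRecolored (keep G M) (recolor G M)).Isomorphic
        (H.induceRecolored (keep H (e.toIso '' M)) (recolor H (e.toIso '' M)))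

namespace ReplacementOperator

variable {C : GraphClass} {D : DecompositionFunctor C} (R : ReplacementOperator D)

open Classical in
/-- The replacement operator is polynomial-time computable. The input is a graph with the membership
vector of a module; the output tells for each vertex whether it is maintained and, if so, its new
color. -/
def PolyTime : Prop :=
  ComputableInPolyTime
    (ι := {x : (G : FinColoredGraph) × Set (Fin G.n) //
      x.1.toColoredGraph.InClass C ∧ x.2 ∈ D.modules x.1.toColoredGraph ∧
        x.1.toColoredGraph.Nontrivial x.2})
    (fun x => .node x.1.1.encode (.ofVector fun v => .ofProp (v ∈ x.1.2)))
    (fun x => .ofVector fun v : Fin x.1.1.n =>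
      if v ∈ R.keep x.1.1.toColoredGraph x.1.2 then
        .node .nil (R.recolor x.1.1.toColoredGraph x.1.2 v)
      else .nil)

/-- The vertices that remain when all non-trivial modules are replaced simultaneously. -/
def remaining (G : ColoredGraph) : Set G.V :=
  {v | G.Nontrivial (D.block G v) → v ∈ R.keep G (D.block G v)}

open Classical in
/-- The color of `v` after the replacement. -/
noncomputable def newColor (G : ColoredGraph) (v : G.V) : TreeData :=
  if G.Nontrivial (D.block G v) then R.recolor G (D.block G v) v else G.color v

/-- The sorted list of the colors (in `G`) of the vertices of `M` with the adjacency type of `v`. -/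
noncomputable def typeColors (G : ColoredGraph) (M : Set G.V) (v : G.V) : TreeData :=
  .ofList <| Finset.sort
    (Set.toFinite (G.color '' {w | w ∈ M ∧ G.adjType M w = G.adjType M v})).toFinset

/-- The quotient graph: all non-trivial modules are replaced, and each vertex `v` gets as its color
the triple consisting of its color after the replacement, the list of the colors of the vertices of
its module with the same adjacency type, and the invariant of its module. -/
noncomputable def quotient (I : ColoredGraph → TreeData) (G : ColoredGraph) : ColoredGraph :=
  G.induceRecolored (R.remaining G) fun v =>
    .node (R.newColor G v)
      (.node (typeColors G (D.block G v) v) (I (G.induce (D.block G v))))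

/-- The decomposition functor is simple with respect to the replacement operator: for every complete
invariant, all quotient graphs are prime. -/
def Simple : Prop :=
  ∀ I, IsCompleteInvariant C I → ∀ G : ColoredGraph, G.InClass C → D.Prime (R.quotient I G)

/-- The replacement operator is reversible: graphs are isomorphic if and only if their quotient
graphs are. -/
def Reversible : Prop :=
  ∀ I, IsCompleteInvariant C I → ∀ G H : ColoredGraph, G.InClass C → H.InClass C →
    (G.Isomorphic H ↔ (R.quotient I G).Isomorphic (R.quotient I H))

end ReplacementOperator

/-!
Call an equivalence relation on the vertices of a graph *split* if each of its classes induces a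
graph in `C`. The two input graphs `G` and `H` are the two classes of such a relation on their
disjoint union. `DecompositionFunctor.refine` splits every class into the blocks of the
decomposition of the subgraph it induces. A block is a proper subset of its class unless the class
is a single vertex, so after as many refinements as there are vertices all classes are singletons
(`DecompositionFunctor.Splits.eq_of_iterate`).

The algorithm then goes back from the finest partition to the coarsest one and computes a value for
each class such that two classes of the same partition have the same value if and only if they
induce isomorphic graphs. For singletons the code of the induced graph will do. Suppose that the
values are known for the blocks of the classes of a partition. A complete invariant of all graphs
need not be computable in polynomial time, but the values of these finitely many graphs extend to
some complete invariant `I` (`IsInvariantOn.exists_completeInvariant`), and the quotients of the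
classes with respect to `I` involve only values that are known. These quotients are prime by
simplicity, so the given algorithm decides which of them are isomorphic, and by reversibility this
tells which classes induce isomorphic graphs. Each class receives the code of the first class with
an isomorphic quotient (`ReplacementOperator.isInvariantOn_nextVal`). The invariant `I` thus depends
on the input and on the round. As a quotient is never decomposed any further and a value is the code
of an induced subgraph of the input, all intermediate results have polynomial size.

To see that this runs in polynomial time, `ComputableInPolyTime` is shown to be closed under
composition, case distinction and loops with polynomially many passes and states of polynomial size
(`ComputableInPolyTime.loop`), and hence under quantifiers over vertices
(`ComputableInPolyTime.exists_fin`) and the formation of vectors and lists indexed by vertices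
(`ComputableInPolyTime.finFilter_map`). Vertices are represented by unary numbers, and a statement
about a bound vertex is evaluated on the input paired with that vertex (`withVertex`). Most steps of
the algorithm are written as formulas in this language. Two need loops of their own: the comparison
of two data values (`ComputableInPolyTime.compare_final`) and the sorting of colors
(`ComputableInPolyTime.sort_image`).
-/

/-! ### Polynomial bounds -/

theorem Polynomial.eval_mono_nat (q : Polynomial ℕ) {m n : ℕ} (h : m ≤ n) :
    q.eval m ≤ q.eval n := by
  simp only [Polynomial.eval_eq_sum, Polynomial.sum]
  gcongr

/-- The numbers `f i` are bounded by a polynomial in the size of `e i`. -/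
def PolyBounded {ι : Type*} (e : ι → TreeData) (f : ι → ℕ) : Prop :=
  ∃ q : Polynomial ℕ, ∀ i, f i ≤ q.eval (e i).size

namespace PolyBounded

variable {ι κ : Type*} {e : ι → TreeData} {f g : ι → ℕ}

theorem mono (hg : PolyBounded e g) (h : ∀ i, f i ≤ g i) : PolyBounded e f :=
  hg.imp fun _ hq i => (h i).trans (hq i)

theorem const (n : ℕ) : PolyBounded e fun _ => n :=
  ⟨Polynomial.C n, fun i => by simp⟩

theorem size : PolyBounded e fun i => (e i).size :=
  ⟨Polynomial.X, fun i => by simp⟩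

theorem add (hf : PolyBounded e f) (hg : PolyBounded e g) : PolyBounded e fun i => f i + g i := by
  obtain ⟨p, hp⟩ := hf
  obtain ⟨q, hq⟩ := hg
  exact ⟨p + q, fun i => by simpa using add_le_add (hp i) (hq i)⟩

theorem mul (hf : PolyBounded e f) (hg : PolyBounded e g) : PolyBounded e fun i => f i * g i := by
  obtain ⟨p, hp⟩ := hf
  obtain ⟨q, hq⟩ := hg
  exact ⟨p * q, fun i => by simpa using Nat.mul_le_mul (hp i) (hq i)⟩

theorem eval (hf : PolyBounded e f) (q : Polynomial ℕ) : PolyBounded e fun i => q.eval (f i) := by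
  obtain ⟨p, hp⟩ := hf
  exact ⟨q.comp p, fun i => by simpa using q.eval_mono_nat (hp i)⟩

theorem reindex (hf : PolyBounded e f) (φ : κ → ι) :
    PolyBounded (fun k => e (φ k)) fun k => f (φ k) :=
  hf.imp fun _ hq k => hq (φ k)

/-- Polynomial bounds compose. -/
theorem trans {e' : κ → TreeData} {φ : κ → ι} (hf : PolyBounded e f)
    (he : PolyBounded e' fun k => (e (φ k)).size) : PolyBounded e' fun k => f (φ k) := by
  obtain ⟨q, hq⟩ := hf
  exact (he.eval q).mono fun k => hq (φ k)

end PolyBounded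

/-! ### Elementary polynomial-time computations -/

theorem TreeData.one_le_size (x : TreeData) : 1 ≤ x.size := by
  cases x <;> simp only [TreeData.size] <;> omega

theorem TreeData.size_left_le (x : TreeData) : x.left.size ≤ x.size := by
  cases x <;> simp [TreeData.size, TreeData.left]; omega

theorem TreeData.size_right_le (x : TreeData) : x.right.size ≤ x.size := by
  cases x <;> simp [TreeData.size, TreeData.right]

theorem WhileProg.Eval.size_le {p : WhileProg} {x y : TreeData} {t : ℕ} (h : p.Eval x y t) :
    y.size ≤ t := by
  induction h with
  | id x => exact le_rfl
  | nil x => exact x.one_le_size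
  | left x => exact x.size_left_le
  | right x => exact x.size_right_le
  | node _ _ h₁ h₂ => simp only [TreeData.size]; omega
  | comp _ _ _ h => omega
  | ite_true _ _ _ h => omega
  | ite_false _ _ _ h => omega
  | loop_done _ _ => omega
  | loop_step _ _ _ _ _ h => omega

namespace TreeData

/-- Natural numbers in unary, as lists of leaves. -/
def ofNat (n : ℕ) : TreeData := ofList (List.replicate n nil)

theorem ofNat_succ (n : ℕ) : ofNat (n + 1) = node nil (ofNat n) := by
  simp [ofNat, List.replicate_succ, ofList]

theorem size_ofNat (n : ℕ) : (ofNat n).size = 2 * n + 1 := by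
  induction n with
  | zero => rfl
  | succ n ih => rw [ofNat_succ]; simp only [size, ih]; omega

theorem ofNat_injective : Function.Injective ofNat := fun m n h => by
  have := congrArg size h
  simp only [size_ofNat] at this
  omega

theorem size_ofProp_le (p : Prop) : (ofProp p).size ≤ 3 := by
  unfold ofProp; split <;> simp [size]

theorem ofProp_true {p : Prop} (h : p) : ofProp p = node nil nil := if_pos h

theorem ofProp_false {p : Prop} (h : ¬ p) : ofProp p = nil := if_neg h

theorem ofList_injective : Function.Injective ofList
  | [], [], _ => rfl
  | [], _ :: _, h => by simp [ofList] at h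
  | _ :: _, [], h => by simp [ofList] at h
  | a :: l, b :: m, h => by
    simp only [ofList, node.injEq] at h
    rw [h.1, ofList_injective h.2]

theorem length_le_size_ofList (l : List TreeData) : l.length ≤ (ofList l).size := by
  induction l with
  | nil => simp
  | cons a l ih => simp only [ofList, size, List.length_cons]; omega

theorem size_ofList_le {l : List TreeData} {b : ℕ} (h : ∀ a ∈ l, a.size ≤ b) :
    (ofList l).size ≤ l.length * (b + 1) + 1 := by
  induction l with
  | nil => simp [ofList, size]
  | cons a l ih =>
    have h₁ := h a (by simp)
    have h₂ := ih fun c hc => h c (by simp [hc])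
    simp only [ofList, size, List.length_cons, add_mul]
    omega

theorem size_ofList_drop_le (l : List TreeData) (k : ℕ) :
    (ofList (l.drop k)).size ≤ (ofList l).size := by
  induction l generalizing k with
  | nil => simp
  | cons a l ih =>
    cases k with
    | zero => simp
    | succ k => simp only [List.drop_succ_cons, ofList, size]; have := ih k; omega

end TreeData

open TreeData

namespace ComputableInPolyTime

variable {ι κ : Type*} {e : ι → TreeData} {f g : ι → TreeData}

theorem of_eval (p : WhileProg) {b : ι → ℕ} (hb : PolyBounded e b)
    (h : ∀ i, ∃ t ≤ b i, p.Eval (e i) (f i) t) : ComputableInPolyTime e f := by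
  obtain ⟨q, hq⟩ := hb
  exact ⟨p, q, fun i => (h i).imp fun t ht => ⟨ht.1.trans (hq i), ht.2⟩⟩

/-- In polynomial time only outputs of polynomial size can be produced. -/
theorem polyBounded (h : ComputableInPolyTime e f) : PolyBounded e fun i => (f i).size := by
  obtain ⟨p, q, h⟩ := h
  exact ⟨q, fun i => let ⟨_, ht, hp⟩ := h i; hp.size_le.trans ht⟩

theorem id : ComputableInPolyTime e e :=
  of_eval .id .size fun i => ⟨_, le_rfl, .id (e i)⟩

theorem congr (h : ComputableInPolyTime e f) (hfg : ∀ i, f i = g i) :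
    ComputableInPolyTime e g := by
  rwa [← funext hfg]

theorem reindex (h : ComputableInPolyTime e f) (φ : κ → ι) :
    ComputableInPolyTime (fun k => e (φ k)) fun k => f (φ k) :=
  let ⟨p, q, h⟩ := h
  ⟨p, q, fun k => h (φ k)⟩

/-- Substitution of computed instances into a solved problem. -/
theorem subst {e' : κ → TreeData} {φ : κ → ι} (h : ComputableInPolyTime e f)
    (he : ComputableInPolyTime e' fun k => e (φ k)) :
    ComputableInPolyTime e' fun k => f (φ k) := by
  obtain ⟨p, q, hp⟩ := h
  have hb := he.polyBounded.eval q
  obtain ⟨p', q', hp'⟩ := he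
  refine of_eval (.comp p p') (b := fun k => q'.eval (e' k).size + q.eval (e (φ k)).size + 1)
    (.add (.add (.eval .size q') hb) (.const 1)) fun k => ?_
  obtain ⟨s, hs, hs'⟩ := hp' k
  obtain ⟨t, ht, ht'⟩ := hp (φ k)
  exact ⟨s + t + 1, by omega, .comp hs' ht'⟩

theorem trans (h : ComputableInPolyTime e f) (h' : ComputableInPolyTime f g) :
    ComputableInPolyTime e g :=
  h'.subst (φ := fun i => i) h

theorem node (hf : ComputableInPolyTime e f) (hg : ComputableInPolyTime e g) :
    ComputableInPolyTime e fun i => .node (f i) (g i) := by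
  obtain ⟨p, q, hp⟩ := hf
  obtain ⟨p', q', hp'⟩ := hg
  refine of_eval (.node p p') (b := fun i => q.eval (e i).size + q'.eval (e i).size + 1)
    (.add (.add (.eval .size q) (.eval .size q')) (.const 1)) fun i => ?_
  obtain ⟨s, hs, hs'⟩ := hp i
  obtain ⟨t, ht, ht'⟩ := hp' i
  exact ⟨s + t + 1, by omega, .node hs' ht'⟩

theorem left (h : ComputableInPolyTime e f) : ComputableInPolyTime e fun i => (f i).left :=
  h.trans (of_eval .left .size fun i => ⟨_, le_rfl, .left (f i)⟩)

theorem right (h : ComputableInPolyTime e f) : ComputableInPolyTime e fun i => (f i).right :=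
  h.trans (of_eval .right .size fun i => ⟨_, le_rfl, .right (f i)⟩)

theorem fst (h : ComputableInPolyTime e fun i => .node (f i) (g i)) : ComputableInPolyTime e f :=
  h.left

theorem snd (h : ComputableInPolyTime e fun i => .node (f i) (g i)) : ComputableInPolyTime e g :=
  h.right

theorem const (a : TreeData) : ComputableInPolyTime e fun _ => a := by
  induction a with
  | nil => exact of_eval .nil .size fun i => ⟨_, le_rfl, .nil (e i)⟩
  | node a b ha hb => exact ha.node hb

open Classical in
/-- A case distinction. Each branch needs to be correct only on the instances that reach it. -/
theorem ite {p : ι → Prop} (hp : ComputableInPolyTime e fun i => ofProp (p i))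
    (hf : ComputableInPolyTime (fun i : {i // p i} => e i.1) fun i => f i.1)
    (hg : ComputableInPolyTime (fun i : {i // ¬ p i} => e i.1) fun i => g i.1) :
    ComputableInPolyTime e fun i => if p i then f i else g i := by
  obtain ⟨c, q, hc⟩ := hp
  obtain ⟨p₁, q₁, hp₁⟩ := hf
  obtain ⟨p₂, q₂, hp₂⟩ := hg
  refine of_eval (.ite c p₁ p₂)
    (b := fun i => q.eval (e i).size + (q₁.eval (e i).size + q₂.eval (e i).size) + 1)
    (.add (.add (.eval .size q) (.add (.eval .size q₁) (.eval .size q₂))) (.const 1)) fun i => ?_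
  obtain ⟨s, hs, hs'⟩ := hc i
  dsimp only at hs'
  by_cases h : p i
  · obtain ⟨t, ht, ht'⟩ := hp₁ ⟨i, h⟩
    rw [ofProp_true h] at hs'
    rw [if_pos h]
    exact ⟨s + t + 1, by dsimp at *; omega, .ite_true hs' ht'⟩
  · obtain ⟨t, ht, ht'⟩ := hp₂ ⟨i, h⟩
    rw [ofProp_false h] at hs'
    rw [if_neg h]
    exact ⟨s + t + 1, by dsimp at *; omega, .ite_false hs' ht'⟩

open Classical in
theorem ite_total {p : ι → Prop} (hp : ComputableInPolyTime e fun i => ofProp (p i))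
    (hf : ComputableInPolyTime e f) (hg : ComputableInPolyTime e g) :
    ComputableInPolyTime e fun i => if p i then f i else g i :=
  hp.ite (hf.reindex _) (hg.reindex _)

/-- Whether a value is a leaf can be tested. -/
theorem ne_nil (hf : ComputableInPolyTime e f) :
    ComputableInPolyTime e fun i => ofProp (f i ≠ .nil) := by
  refine hf.trans (of_eval (.ite .id (.node .nil .nil) .nil)
    (b := fun i => (f i).size + ((f i).size + (f i).size + 1) + 1)
    (.add (.add .size (.add (.add .size .size) (.const 1))) (.const 1)) fun i => ?_)
  cases h : f i with
  | nil =>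
    rw [ofProp_false (by simp)]
    exact ⟨_, by simp [size], .ite_false (.id _) (.nil _)⟩
  | node a b =>
    rw [ofProp_true (by simp)]
    exact ⟨_, le_rfl, .ite_true (.id _) (.node (.nil _) (.nil _))⟩

theorem not {p : ι → Prop} (hp : ComputableInPolyTime e fun i => ofProp (p i)) :
    ComputableInPolyTime e fun i => ofProp (¬ p i) :=
  (hp.ite_total (const .nil) (const (.node .nil .nil))).congr fun i => by
    by_cases h : p i <;> simp [h, ofProp]

/-- For a conjunction, the second condition has to be decided only where the first one holds. -/
theorem and_of_imp {p q : ι → Prop} (hp : ComputableInPolyTime e fun i => ofProp (p i))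
    (hq : ComputableInPolyTime (fun i : {i // p i} => e i.1) fun i => ofProp (q i.1)) :
    ComputableInPolyTime e fun i => ofProp (p i ∧ q i) :=
  (hp.ite (f := fun i => ofProp (q i)) (g := fun _ => .nil) hq (const .nil)).congr fun i => by
    by_cases h : p i
    · rw [if_pos h]; simp only [h, true_and]
    · rw [if_neg h, ofProp_false fun h' => h h'.1]

theorem and {p q : ι → Prop} (hp : ComputableInPolyTime e fun i => ofProp (p i))
    (hq : ComputableInPolyTime e fun i => ofProp (q i)) :
    ComputableInPolyTime e fun i => ofProp (p i ∧ q i) :=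
  hp.and_of_imp (hq.reindex _)

theorem imp_of_imp {p q : ι → Prop} (hp : ComputableInPolyTime e fun i => ofProp (p i))
    (hq : ComputableInPolyTime (fun i : {i // p i} => e i.1) fun i => ofProp (q i.1)) :
    ComputableInPolyTime e fun i => ofProp (p i → q i) :=
  (hp.and_of_imp hq.not).not.congr fun i => by rw [not_and, not_not]

theorem imp {p q : ι → Prop} (hp : ComputableInPolyTime e fun i => ofProp (p i))
    (hq : ComputableInPolyTime e fun i => ofProp (q i)) :
    ComputableInPolyTime e fun i => ofProp (p i → q i) :=
  hp.imp_of_imp (hq.reindex _)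

theorem or {p q : ι → Prop} (hp : ComputableInPolyTime e fun i => ofProp (p i))
    (hq : ComputableInPolyTime e fun i => ofProp (q i)) :
    ComputableInPolyTime e fun i => ofProp (p i ∨ q i) :=
  (hp.not.imp hq).congr fun i => by rw [or_iff_not_imp_left]

theorem iff {p q : ι → Prop} (hp : ComputableInPolyTime e fun i => ofProp (p i))
    (hq : ComputableInPolyTime e fun i => ofProp (q i)) :
    ComputableInPolyTime e fun i => ofProp (p i ↔ q i) :=
  ((hp.imp hq).and (hq.imp hp)).congr fun i => by rw [iff_def]

theorem ofNat_zero : ComputableInPolyTime e fun _ => ofNat 0 := const .nil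

theorem ofNat_succ {n : ι → ℕ} (h : ComputableInPolyTime e fun i => ofNat (n i)) :
    ComputableInPolyTime e fun i => ofNat (n i + 1) :=
  ((const .nil).node h).congr fun _ => (TreeData.ofNat_succ _).symm

/-! ### Loops -/

/-- A loop runs in polynomial time if the number of passes and the sizes of all intermediate states
are polynomially bounded. The states of instance `i` are `st i 0, ..., st i (T i)`. -/
theorem loop {st : ι → ℕ → TreeData} {T : ι → ℕ}
    (init : ComputableInPolyTime e fun i => st i 0)
    (cond : ComputableInPolyTime (fun x : {x : ι × ℕ // x.2 ≤ T x.1} => st x.1.1 x.1.2)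
      fun x => ofProp (x.1.2 < T x.1.1))
    (step : ComputableInPolyTime (fun x : {x : ι × ℕ // x.2 < T x.1} => st x.1.1 x.1.2)
      fun x => st x.1.1 (x.1.2 + 1))
    (hT : PolyBounded e T)
    (hst : PolyBounded (fun x : {x : ι × ℕ // x.2 ≤ T x.1} => e x.1.1)
      fun x => (st x.1.1 x.1.2).size) :
    ComputableInPolyTime e fun i => st i (T i) := by
  obtain ⟨p, q, hp⟩ := init
  obtain ⟨pc, qc, hc⟩ := cond
  obtain ⟨pf, qf, hf⟩ := step
  obtain ⟨qs, hs⟩ := hst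
  let B : ι → ℕ := fun i => qs.eval (e i).size
  have hB : PolyBounded e B := .eval .size qs
  -- the cost of one pass
  let K : ι → ℕ := fun i => qc.eval (B i) + qf.eval (B i) + B i + 1
  have hK : PolyBounded e K := .add (.add (.add (.eval hB qc) (.eval hB qf)) hB) (.const 1)
  refine of_eval (.comp (.loop pc pf) p) (b := fun i => q.eval (e i).size + (T i + 1) * K i + 1)
    (.add (.add (.eval .size q) (.mul (.add hT (.const 1)) hK)) (.const 1)) fun i => ?_
  have key : ∀ m k, k + m = T i →
      ∃ t ≤ (m + 1) * K i, (WhileProg.loop pc pf).Eval (st i k) (st i (T i)) t := by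
    intro m
    induction m with
    | zero =>
      intro k hk
      obtain ⟨s, h₁, h₂⟩ := hc ⟨(i, k), by dsimp; omega⟩
      have h₃ := hs ⟨(i, k), by dsimp; omega⟩
      dsimp at h₁ h₂ h₃
      rw [ofProp_false (by omega)] at h₂
      have h₄ := qc.eval_mono_nat h₃
      obtain rfl : k = T i := by omega
      exact ⟨_, by dsimp [K, B]; omega, .loop_done h₂⟩
    | succ m ih =>
      intro k hk
      obtain ⟨s, h₁, h₂⟩ := hc ⟨(i, k), by dsimp; omega⟩
      obtain ⟨s', h₁', h₂'⟩ := hf ⟨(i, k), by dsimp; omega⟩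
      have h₃ := hs ⟨(i, k), by dsimp; omega⟩
      dsimp at h₁ h₂ h₃ h₁' h₂'
      rw [ofProp_true (by omega)] at h₂
      have h₄ := qc.eval_mono_nat h₃
      have h₅ := qf.eval_mono_nat h₃
      obtain ⟨t, ht, ht'⟩ := ih (k + 1) (by omega)
      refine ⟨_, ?_, .loop_step h₂ h₂' ht'⟩
      have : s + s' + 1 ≤ K i := by dsimp [K, B]; omega
      rw [add_mul (m + 1), one_mul]
      omega
  obtain ⟨s, h₁, h₂⟩ := hp i
  obtain ⟨t, ht, ht'⟩ := key (T i) 0 (by omega)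
  exact ⟨_, by omega, .comp h₂ ht'⟩

theorem _root_.PolyBounded.length {l : ι → List TreeData}
    (hl : PolyBounded e fun i => (ofList (l i)).size) : PolyBounded e fun i => (l i).length :=
  hl.mono fun _ => length_le_size_ofList _

theorem _root_.PolyBounded.ofNat {n : ι → ℕ}
    (hn : PolyBounded e fun i => (ofNat (n i)).size) : PolyBounded e n :=
  hn.mono fun i => by rw [size_ofNat]; omega

/-- Iteration over a list. A step may use the part of the list that has not yet been processed. -/
theorem fold {l : ι → List TreeData} {s : ι → ℕ → TreeData}
    (hl : ComputableInPolyTime e fun i => ofList (l i))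
    (init : ComputableInPolyTime e fun i => s i 0)
    (step : ComputableInPolyTime
      (fun x : {x : ι × ℕ // x.2 < (l x.1).length} =>
        .node (e x.1.1) (.node (ofList ((l x.1.1).drop x.1.2)) (s x.1.1 x.1.2)))
      fun x => s x.1.1 (x.1.2 + 1))
    (bound : PolyBounded (fun x : {x : ι × ℕ // x.2 ≤ (l x.1).length} => e x.1.1)
      fun x => (s x.1.1 x.1.2).size) :
    ComputableInPolyTime e fun i => s i (l i).length := by
  have hb := hl.polyBounded
  have := loop (e := e) (T := fun i => (l i).length)
    (st := fun i k => .node (e i) (.node (ofList ((l i).drop k)) (s i k)))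
    (id.node (hl.node init)) ?_ ?_ hb.length ?_
  · exact this.snd.snd
  · refine id.snd.fst.ne_nil.congr fun x => ?_
    congr 1
    apply propext
    rw [← not_le, ← List.drop_eq_nil_iff]
    cases (l x.1.1).drop x.1.2 <;> simp [ofList]
  · refine id.fst.node (.node ?_ step)
    exact id.snd.fst.right.congr fun x => by
      rw [← List.tail_drop]
      cases (l x.1.1).drop x.1.2 <;> rfl
  · refine .mono (g := fun x => 1 + (e x.1.1).size + (1 + (ofList (l x.1.1)).size +
      (s x.1.1 x.1.2).size)) (.add (.add (.const _) .size) (.add (.add (.const _) ?_) bound)) ?_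
    · exact hb.reindex _
    · intro x
      have := size_ofList_drop_le (l x.1.1) x.1.2
      simp only [size]
      omega

end ComputableInPolyTime

open Classical in
/-- The increasing list of the indices with property `p`. -/
noncomputable def finFilter {n : ℕ} (p : Fin n → Prop) : List (Fin n) :=
  (List.finRange n).filter fun v => decide (p v)

theorem mem_finFilter {n : ℕ} {p : Fin n → Prop} {v : Fin n} : v ∈ finFilter p ↔ p v := by
  simp [finFilter]

theorem nodup_finFilter {n : ℕ} (p : Fin n → Prop) : (finFilter p).Nodup :=
  (List.nodup_finRange n).filter _

theorem finFilter_true (n : ℕ) : finFilter (fun _ : Fin n => True) = List.finRange n := by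
  simp [finFilter]

theorem TreeData.ofVector_eq {n : ℕ} (f : Fin n → TreeData) :
    ofVector f = ofList ((List.finRange n).map f) := by
  rw [ofVector, List.ofFn_eq_map]

theorem TreeData.size_ofVector_le {n : ℕ} {f : Fin n → TreeData} {b : ℕ}
    (h : ∀ v, (f v).size ≤ b) : (ofVector f).size ≤ n * (b + 1) + 1 := by
  rw [ofVector_eq]
  refine (size_ofList_le (b := b) ?_).trans_eq (by simp)
  simpa using h

theorem TreeData.ofVector_get_map {α : Type*} (l : List α) (f : α → TreeData) :
    ofVector (fun i => f (l.get i)) = ofList (l.map f) := by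
  rw [ofVector_eq]
  conv_rhs => rw [← List.map_get_finRange l]
  rw [List.map_map]
  rfl

/-- An input together with a vertex: the context in which a statement about a bound vertex is
evaluated. -/
abbrev withVertex {ι : Type*} (e : ι → TreeData) (n : ι → ℕ) (x : Σ i, Fin (n i)) : TreeData :=
  .node (e x.1) (ofNat x.2)

namespace ComputableInPolyTime

variable {ι : Type*} {e : ι → TreeData} {f : ι → TreeData} {n : ι → ℕ}

/-- The context may be enlarged by a bound vertex. -/
theorem weaken (hf : ComputableInPolyTime e f) :
    ComputableInPolyTime (withVertex e n) fun x => f x.1 :=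
  hf.subst id.fst

theorem vertex : ComputableInPolyTime (withVertex e n) fun x => ofNat x.2 :=
  id.snd

/-- Iteration with a counter that runs downwards from `n i - 1` to `0`. -/
theorem countdown {s : ι → ℕ → TreeData}
    (hn : ComputableInPolyTime e fun i => ofNat (n i))
    (init : ComputableInPolyTime e fun i => s i (n i))
    (step : ComputableInPolyTime
      (fun x : Σ i, Fin (n i) => .node (withVertex e n x) (s x.1 (x.2 + 1))) fun x => s x.1 x.2)
    (bound : PolyBounded (fun x : {x : ι × ℕ // x.2 ≤ n x.1} => e x.1.1)
      fun x => (s x.1.1 x.1.2).size) :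
    ComputableInPolyTime e fun i => s i 0 := by
  have := fold (e := e) (l := fun i => List.replicate (n i) .nil) (s := fun i k => s i (n i - k))
    hn init ?_ ?_
  · exact this.congr fun i => by simp
  · let φ : {x : ι × ℕ // x.2 < (List.replicate (n x.1) TreeData.nil).length} → Σ i, Fin (n i) :=
      fun x => ⟨x.1.1, ⟨n x.1.1 - (x.1.2 + 1), by have := x.2; simp at this; omega⟩⟩
    refine step.subst (φ := φ) (.node (.node id.fst ?_) (id.snd.snd.congr fun x => ?_))
    · refine id.snd.fst.right.congr fun x => ?_
      have := x.2
      simp only [List.length_replicate] at this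
      obtain ⟨m, hm⟩ : ∃ m, n x.1.1 - x.1.2 = m + 1 := ⟨n x.1.1 - x.1.2 - 1, by omega⟩
      simp only [List.drop_replicate, φ, ofNat]
      rw [hm, show n x.1.1 - (x.1.2 + 1) = m by omega]
      rfl
    · have := x.2
      simp only [List.length_replicate] at this
      simp only [φ]
      congr 1
      omega
  · refine bound.reindex (fun x : {x : ι × ℕ // x.2 ≤ (List.replicate (n x.1) TreeData.nil).length}
      => ⟨(x.1.1, n x.1.1 - x.1.2), by dsimp; omega⟩)

/-! ### Lists and vectors -/

theorem drop {l : ι → List TreeData} {k : ι → ℕ}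
    (hl : ComputableInPolyTime e fun i => ofList (l i))
    (hk : ComputableInPolyTime e fun i => ofNat (k i)) :
    ComputableInPolyTime e fun i => ofList ((l i).drop (k i)) := by
  have := fold (e := e) (l := fun i => List.replicate (k i) .nil)
    (s := fun i j => ofList ((l i).drop j)) hk hl ?_ ?_
  · exact this.congr fun i => by simp
  · exact id.snd.snd.right.congr fun x => by
      rw [← List.tail_drop]
      cases (l x.1.1).drop x.1.2 <;> rfl
  · exact (hl.polyBounded.reindex _).mono fun x => size_ofList_drop_le _ _

theorem get {l : ι → List TreeData} {k : ∀ i, Fin (l i).length}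
    (hl : ComputableInPolyTime e fun i => ofList (l i))
    (hk : ComputableInPolyTime e fun i => ofNat (k i)) :
    ComputableInPolyTime e fun i => (l i).get (k i) :=
  (hl.drop hk).left.congr fun i => by
    rw [List.drop_eq_getElem_cons (k i).2]
    rfl

theorem ofVector_apply {f : ∀ i, Fin (n i) → TreeData} {v : ∀ i, Fin (n i)}
    (hf : ComputableInPolyTime e fun i => ofVector (f i))
    (hv : ComputableInPolyTime e fun i => ofNat (v i)) :
    ComputableInPolyTime e fun i => f i (v i) :=
  (get (k := fun i => Fin.cast (by simp) (v i)) hf hv).congr fun i => by simp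

theorem ofRel_apply {r : ∀ i, Fin (n i) → Fin (n i) → Prop} {v w : ∀ i, Fin (n i)}
    (hr : ComputableInPolyTime e fun i => ofRel (r i))
    (hv : ComputableInPolyTime e fun i => ofNat (v i))
    (hw : ComputableInPolyTime e fun i => ofNat (w i)) :
    ComputableInPolyTime e fun i => ofProp (r i (v i) (w i)) :=
  (hr.ofVector_apply hv).ofVector_apply hw

theorem length {l : ι → List TreeData} (hl : ComputableInPolyTime e fun i => ofList (l i)) :
    ComputableInPolyTime e fun i => ofNat (l i).length := by
  refine fold (s := fun _ k => ofNat k) hl ofNat_zero id.snd.snd.ofNat_succ ?_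
  refine ((hl.polyBounded.reindex _).add ((hl.polyBounded.reindex _).add (.const 1))).mono
    fun x => ?_
  rw [size_ofNat]
  have := length_le_size_ofList (l x.1.1)
  have := x.2
  omega

/-- Pairing the input with a vertex increases its size only polynomially. -/
theorem polyBounded_withVertex (hn : ComputableInPolyTime e fun i => ofNat (n i)) :
    PolyBounded (fun x : Σ i, Fin (n i) => e x.1) fun x => (withVertex e n x).size := by
  have := hn.polyBounded.reindex (fun x : Σ i, Fin (n i) => x.1)
  refine (PolyBounded.add (.const 1) (PolyBounded.add .size this)).mono fun x => ?_
  simp only [size, size_ofNat]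
  omega

/-- List comprehension. The entries need to be computable only at the listed indices. -/
theorem finFilter_map {p : ∀ i, Fin (n i) → Prop} {f : ∀ i, Fin (n i) → TreeData}
    (hn : ComputableInPolyTime e fun i => ofNat (n i))
    (hp : ComputableInPolyTime (withVertex e n) fun x => ofProp (p x.1 x.2))
    (hf : ComputableInPolyTime
      (fun x : {x : Σ i, Fin (n i) // p x.1 x.2} => withVertex e n x.1) fun x => f x.1.1 x.1.2) :
    ComputableInPolyTime e fun i => ofList ((finFilter (p i)).map (f i)) := by
  classical
  -- the list is built from its end; `s i k` holds the entries with index at least `k`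
  let s : ι → ℕ → TreeData := fun i k =>
    ofList ((((List.finRange (n i)).drop k).filter fun v => decide (p i v)).map (f i))
  have hs : ∀ x : Σ i, Fin (n i), (if p x.1 x.2 then .node (f x.1 x.2) (s x.1 (x.2 + 1))
      else s x.1 (x.2 + 1)) = s x.1 x.2 := fun x => by
    have h : (x.2 : ℕ) < (List.finRange (n x.1)).length := by simp
    simp only [s]
    rw [List.drop_eq_getElem_cons h]
    by_cases hx : p x.1 x.2 <;> simp [hx, ofList]
  refine countdown (s := s) hn ?_ ?_ ?_
  · exact (const .nil).congr fun i => by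
      simp only [s]
      rw [List.drop_eq_nil_of_le (by simp)]
      rfl
  · refine congr (ite (hp.subst id.fst) ?_ ?_) hs
    · exact .node (hf.subst id.fst) id.snd
    · exact id.snd
  · have h₁ := hf.polyBounded.trans
      (e' := fun x : {x : Σ i, Fin (n i) // p x.1 x.2} => e x.1.1) (φ := fun x => x)
      (hn.polyBounded_withVertex.reindex Subtype.val)
    obtain ⟨q, hq⟩ := h₁
    have h₂ : PolyBounded e n := hn.polyBounded.ofNat
    refine (((h₂.mul ((PolyBounded.size.eval q).add (.const 1))).add (.const 1)).reindex
      (fun x : {x : ι × ℕ // x.2 ≤ n x.1} => x.1.1)).mono fun x => ?_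
    refine (size_ofList_le (b := q.eval (e x.1.1).size) ?_).trans ?_
    · simp only [List.mem_map, List.mem_filter, decide_eq_true_eq]
      rintro _ ⟨v, hv, rfl⟩
      exact hq ⟨⟨x.1.1, v⟩, hv.2⟩
    · gcongr
      rw [List.length_map]
      refine (List.length_filter_le _ _).trans ?_
      simp

theorem tabulate {f : ∀ i, Fin (n i) → TreeData}
    (hn : ComputableInPolyTime e fun i => ofNat (n i))
    (hf : ComputableInPolyTime (withVertex e n) fun x => f x.1 x.2) :
    ComputableInPolyTime e fun i => ofVector (f i) :=
  (finFilter_map (p := fun _ _ => True) hn (const (ofProp True)) (hf.reindex _)).congr fun i => by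
    rw [ofVector_eq, finFilter_true]

theorem tabulate_rel {r : ∀ i, Fin (n i) → Fin (n i) → Prop}
    (hn : ComputableInPolyTime e fun i => ofNat (n i))
    (hr : ComputableInPolyTime (withVertex (withVertex e n) fun x => n x.1)
      fun x => ofProp (r x.1.1 x.1.2 x.2)) :
    ComputableInPolyTime e fun i => ofRel (r i) :=
  .tabulate hn (.tabulate (f := fun (x : Σ i, Fin (n i)) w => ofProp (r x.1 x.2 w)) hn.weaken hr)

theorem exists_fin {p : ∀ i, Fin (n i) → Prop}
    (hn : ComputableInPolyTime e fun i => ofNat (n i))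
    (hp : ComputableInPolyTime (withVertex e n) fun x => ofProp (p x.1 x.2)) :
    ComputableInPolyTime e fun i => ofProp (∃ v, p i v) :=
  (finFilter_map (f := fun _ _ => .nil) hn hp (const _)).ne_nil.congr fun i => by
    congr 1
    apply propext
    simp only [← mem_finFilter (p := p i)]
    cases finFilter (p i) <;> simp [ofList]

theorem forall_fin {p : ∀ i, Fin (n i) → Prop}
    (hn : ComputableInPolyTime e fun i => ofNat (n i))
    (hp : ComputableInPolyTime (withVertex e n) fun x => ofProp (p x.1 x.2)) :
    ComputableInPolyTime e fun i => ofProp (∀ v, p i v) :=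
  (hn.exists_fin (p := fun i v => ¬ p i v) hp.not).not.congr fun i => by
    simp only [not_exists, not_not]

theorem append {l m : ι → List TreeData}
    (hl : ComputableInPolyTime e fun i => ofList (l i))
    (hm : ComputableInPolyTime e fun i => ofList (m i)) :
    ComputableInPolyTime e fun i => ofList (l i ++ m i) := by
  have hsize : ∀ l m : List TreeData,
      (ofList (l ++ m)).size ≤ (ofList l).size + (ofList m).size := fun l m => by
    induction l with
    | nil => simp
    | cons a l ih => simp only [List.cons_append, ofList, size]; omega
  refine countdown (s := fun i k => ofList ((l i).drop k ++ m i)) hl.length ?_ ?_ ?_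
  · exact hm.congr fun i => by simp
  · refine congr (f := fun x => .node ((l x.1).get x.2)
      (ofList ((l x.1).drop (x.2 + 1) ++ m x.1))) ?_ fun x => ?_
    · exact .node (get (hl.subst id.fst.fst) id.fst.snd) id.snd
    rw [List.drop_eq_getElem_cons x.2.2]
    rfl
  · refine ((hl.polyBounded.reindex _).add (hm.polyBounded.reindex _)).mono fun x => ?_
    have := size_ofList_drop_le (l x.1.1) x.1.2
    have := hsize ((l x.1.1).drop x.1.2) (m x.1.1)
    omega

theorem ofNat_add {a b : ι → ℕ} (ha : ComputableInPolyTime e fun i => ofNat (a i))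
    (hb : ComputableInPolyTime e fun i => ofNat (b i)) :
    ComputableInPolyTime e fun i => ofNat (a i + b i) :=
  (append ha hb).congr fun i => by rw [List.replicate_append_replicate]; rfl

open Classical in
theorem list_filter {l : ι → List TreeData} {p : ι → TreeData → Prop}
    (hl : ComputableInPolyTime e fun i => ofList (l i))
    (hp : ComputableInPolyTime (withVertex e fun i => (l i).length)
      fun x => ofProp (p x.1 ((l x.1).get x.2))) :
    ComputableInPolyTime e fun i => ofList ((l i).filter fun a => decide (p i a)) :=
  (finFilter_map (p := fun i v => p i ((l i).get v)) (f := fun i => (l i).get) hl.length hp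
    ((get (l := fun x : Σ i, Fin (l i).length => l x.1) (k := fun x => x.2) hl.weaken
      vertex).reindex _)).congr fun i => by
      conv_rhs => rw [← List.map_get_finRange (l i), List.filter_map]
      rfl

end ComputableInPolyTime

/-! ### Comparing and sorting data values -/

namespace TreeData

/-- One step of the simultaneous traversal of two trees. The state is the list of the pairs of
subtrees that are still to be compared; the step does nothing once a difference is found. -/
def compareStep : List (TreeData × TreeData) → List (TreeData × TreeData)
  | (nil, nil) :: l => l
  | (node a b, node c d) :: l => (a, c) :: (b, d) :: l
  | l => l

/-- The traversal has not yet come to its end or to a difference of the two trees. -/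
def Comparing : List (TreeData × TreeData) → Prop
  | [] => False
  | p :: _ => p.1 ≠ nil ↔ p.2 ≠ nil

/-- The state of the traversal as a data value. -/
def ofPairs (l : List (TreeData × TreeData)) : TreeData := ofList (l.map fun p => node p.1 p.2)

theorem comparing_iff (l : List (TreeData × TreeData)) :
    Comparing l ↔ ofPairs l ≠ nil ∧
      ((ofPairs l).left.left ≠ nil ↔ (ofPairs l).left.right ≠ nil) := by
  cases l <;> simp [Comparing, ofPairs, ofList, TreeData.left, TreeData.right]

open Classical in
theorem ofPairs_compareStep {l : List (TreeData × TreeData)} (h : Comparing l) :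
    ofPairs (compareStep l) = if (ofPairs l).left.left ≠ nil then
      node (node (ofPairs l).left.left.left (ofPairs l).left.right.left)
        (node (node (ofPairs l).left.left.right (ofPairs l).left.right.right) (ofPairs l).right)
      else (ofPairs l).right := by
  match l, h with
  | (nil, nil) :: l, _ => simp [ofPairs, compareStep, ofList, TreeData.left, TreeData.right]
  | (node a b, node c d) :: l, _ =>
    simp [ofPairs, compareStep, ofList, TreeData.left, TreeData.right]
  | (nil, node c d) :: l, h => simp [Comparing] at h
  | (node a b, nil) :: l, h => simp [Comparing] at h

theorem size_ofPairs_compareStep_le (l : List (TreeData × TreeData)) :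
    (ofPairs (compareStep l)).size ≤ (ofPairs l).size := by
  unfold compareStep
  split <;> simp only [ofPairs, List.map_cons, ofList, size] <;> omega

/-- The number of nodes that are still to be visited in the first tree. -/
def pairsMeasure (l : List (TreeData × TreeData)) : ℕ := (l.map fun p => p.1.size).sum

theorem pairsMeasure_compareStep_lt {l : List (TreeData × TreeData)} (h : Comparing l) :
    pairsMeasure (compareStep l) < pairsMeasure l := by
  match l, h with
  | (nil, nil) :: l, _ => simp [pairsMeasure, compareStep, size]
  | (node a b, node c d) :: l, _ =>
    simp only [pairsMeasure, compareStep, size, List.map_cons, List.sum_cons]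
    omega
  | (nil, node c d) :: l, h => simp [Comparing] at h
  | (node a b, nil) :: l, h => simp [Comparing] at h

/-- The bit strings that are still to be compared. -/
def pairsBits (l : List (TreeData × TreeData)) : List Bool × List Bool :=
  (l.flatMap fun p => p.1.bits, l.flatMap fun p => p.2.bits)

/-- A step deletes a common first bit of the two bit strings. -/
theorem pairsBits_compareStep_lt_iff (l : List (TreeData × TreeData)) :
    ((pairsBits (compareStep l)).1 < (pairsBits (compareStep l)).2 ↔
      (pairsBits l).1 < (pairsBits l).2) ∧
    ((pairsBits (compareStep l)).1 = (pairsBits (compareStep l)).2 ↔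
      (pairsBits l).1 = (pairsBits l).2) := by
  unfold compareStep
  split <;> simp [pairsBits, bits]

theorem pairsBits_of_not_comparing {l : List (TreeData × TreeData)} (h : ¬ Comparing l) :
    ((pairsBits l).1 < (pairsBits l).2 ↔ ofPairs l ≠ nil ∧ ¬ (ofPairs l).left.left ≠ nil) ∧
    ((pairsBits l).1 = (pairsBits l).2 ↔ ¬ ofPairs l ≠ nil) := by
  match l, h with
  | [], _ => simp [pairsBits, ofPairs, ofList]
  | (nil, nil) :: l, h => simp [Comparing] at h
  | (node a b, node c d) :: l, h => simp [Comparing] at h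
  | (nil, node c d) :: l, _ =>
    simp [pairsBits, ofPairs, ofList, bits, TreeData.left, List.cons_lt_cons_iff]
  | (node a b, nil) :: l, _ =>
    simp [pairsBits, ofPairs, ofList, bits, TreeData.left, List.cons_lt_cons_iff,
      -not_lt, show ¬ true < false by decide]

/-- The traversal ends, as each step visits a node of the first tree. -/
theorem exists_not_comparing (l : List (TreeData × TreeData)) :
    ∃ k, ¬ Comparing (compareStep^[k] l) := by
  by_contra! h
  have : ∀ k, pairsMeasure (compareStep^[k] l) + k ≤ pairsMeasure l := fun k => by
    induction k with
    | zero => simp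
    | succ k ih =>
      rw [Function.iterate_succ_apply']
      have := pairsMeasure_compareStep_lt (h k)
      omega
  have := this (pairsMeasure l + 1)
  omega

open Classical in
/-- The number of steps of the traversal. -/
noncomputable def compareTime (l : List (TreeData × TreeData)) : ℕ :=
  Nat.find (exists_not_comparing l)

theorem comparing_iff_lt {l : List (TreeData × TreeData)} {k : ℕ} (hk : k ≤ compareTime l) :
    Comparing (compareStep^[k] l) ↔ k < compareTime l := by
  classical
  refine ⟨fun h => lt_of_le_of_ne hk ?_, fun h => not_not.1 (Nat.find_min _ h)⟩
  rintro rfl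
  exact Nat.find_spec (exists_not_comparing l) h

theorem compareTime_le (l : List (TreeData × TreeData)) : compareTime l ≤ pairsMeasure l := by
  have : ∀ k ≤ compareTime l, pairsMeasure (compareStep^[k] l) + k ≤ pairsMeasure l := by
    intro k
    induction k with
    | zero => simp
    | succ k ih =>
      intro hk
      rw [Function.iterate_succ_apply']
      have := pairsMeasure_compareStep_lt ((comparing_iff_lt (by omega : k ≤ _)).2 hk)
      have := ih (by omega)
      omega
  have := this _ le_rfl
  omega

/-- The end of the simultaneous traversal of two trees shows how they compare. -/
theorem compare_result (a b : TreeData) :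
    let s := ofPairs (compareStep^[compareTime [(a, b)]] [(a, b)])
    (a < b ↔ s ≠ nil ∧ ¬ s.left.left ≠ nil) ∧ (a = b ↔ ¬ s ≠ nil) := by
  intro s
  have h := pairsBits_of_not_comparing
    (mt (comparing_iff_lt (l := [(a, b)]) le_rfl).1 (lt_irrefl _))
  rw [← h.1, ← h.2]
  have h' : ∀ k, ((pairsBits (compareStep^[k] [(a, b)])).1 <
      (pairsBits (compareStep^[k] [(a, b)])).2 ↔ a < b) ∧
      ((pairsBits (compareStep^[k] [(a, b)])).1 =
      (pairsBits (compareStep^[k] [(a, b)])).2 ↔ a = b) := fun k => by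
    induction k with
    | zero =>
      simp only [Function.iterate_zero, _root_.id, pairsBits, List.flatMap_cons, List.flatMap_nil,
        List.append_nil, bits_injective.eq_iff, and_true]
      rfl
    | succ k ih =>
      rw [Function.iterate_succ_apply']
      exact ⟨(pairsBits_compareStep_lt_iff _).1.trans ih.1,
        (pairsBits_compareStep_lt_iff _).2.trans ih.2⟩
  exact ⟨(h' _).1.symm, (h' _).2.symm⟩

end TreeData

namespace ComputableInPolyTime

variable {ι : Type*} {e : ι → TreeData} {n : ι → ℕ}

/-- The final state of the simultaneous traversal of two trees, from which `compare_result` reads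
off how they compare. -/
theorem compare_final {a b : ι → TreeData} (ha : ComputableInPolyTime e a)
    (hb : ComputableInPolyTime e b) :
    ComputableInPolyTime e fun i =>
      ofPairs (compareStep^[compareTime [(a i, b i)]] [(a i, b i)]) := by
  refine loop (st := fun i k => ofPairs (compareStep^[k] [(a i, b i)])) ?_ ?_ ?_ ?_ ?_
  · exact (ha.node hb).node (const .nil)
  · refine congr (id.ne_nil.and (id.left.left.ne_nil.iff id.left.right.ne_nil)) fun x => ?_
    rw [← comparing_iff, comparing_iff_lt x.2]
  · refine congr (ite_total id.left.left.ne_nil (.node (.node id.left.left.left id.left.right.left)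
      (.node (.node id.left.left.right id.left.right.right) id.right)) id.right) fun x => ?_
    have hx := (comparing_iff_lt x.2.le).2 x.2
    rw [Function.iterate_succ_apply', ofPairs_compareStep hx]
    split_ifs <;> rfl
  · exact ha.polyBounded.mono fun i => (compareTime_le _).trans (by simp [pairsMeasure])
  · refine (((ha.node hb).node (const .nil)).polyBounded.reindex _).mono fun x => ?_
    obtain ⟨⟨i, k⟩, h⟩ := x
    dsimp only
    clear h
    induction k with
    | zero => exact le_rfl
    | succ k ih =>
      rw [Function.iterate_succ_apply']
      exact (size_ofPairs_compareStep_le _).trans ih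

theorem lt {a b : ι → TreeData} (ha : ComputableInPolyTime e a) (hb : ComputableInPolyTime e b) :
    ComputableInPolyTime e fun i => ofProp (a i < b i) :=
  ((compare_final ha hb).ne_nil.and (compare_final ha hb).left.left.ne_nil.not).congr fun i => by
    rw [(compare_result (a i) (b i)).1]

theorem eq {a b : ι → TreeData} (ha : ComputableInPolyTime e a) (hb : ComputableInPolyTime e b) :
    ComputableInPolyTime e fun i => ofProp (a i = b i) :=
  (compare_final ha hb).ne_nil.not.congr fun i => by rw [(compare_result (a i) (b i)).2]

theorem nat_eq {a b : ι → ℕ} (ha : ComputableInPolyTime e fun i => ofNat (a i))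
    (hb : ComputableInPolyTime e fun i => ofNat (b i)) :
    ComputableInPolyTime e fun i => ofProp (a i = b i) :=
  (ha.eq hb).congr fun i => by rw [ofNat_injective.eq_iff]

theorem fin_eq {a b : ∀ i, Fin (n i)} (ha : ComputableInPolyTime e fun i => ofNat (a i))
    (hb : ComputableInPolyTime e fun i => ofNat (b i)) :
    ComputableInPolyTime e fun i => ofProp (a i = b i) :=
  (ha.nat_eq hb).congr fun i => by rw [Fin.val_inj]

end ComputableInPolyTime

open Classical in
theorem Finset.sort_insert_eq_filter {α : Type*} [LinearOrder α] (a : α) (s : Finset α) :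
    (insert a s).sort = s.sort.filter (fun b => decide (b < a)) ++
      a :: s.sort.filter (fun b => decide (a < b)) := by
  refine List.Perm.eq_of_pairwise' (r := (· ≤ ·)) (Finset.pairwise_sort _ _) ?_ ?_
  · simp only [List.pairwise_append, List.pairwise_cons, List.mem_filter, List.mem_cons,
      decide_eq_true_eq]
    refine ⟨(Finset.pairwise_sort _ _).filter _, ⟨fun b hb => hb.2.le,
      (Finset.pairwise_sort _ _).filter _⟩, ?_⟩
    rintro b hb c (rfl | hc)
    · exact hb.2.le
    · exact (hb.2.trans hc.2).le
  · refine (List.perm_ext_iff_of_nodup (Finset.sort_nodup _ _) ?_).2 fun b => ?_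
    · simp only [List.nodup_append, List.nodup_cons, List.mem_filter, List.mem_cons,
        decide_eq_true_eq, lt_irrefl, and_false, not_false_eq_true, true_and]
      refine ⟨(Finset.sort_nodup _ _).filter _, (Finset.sort_nodup _ _).filter _, ?_⟩
      rintro b hb c (rfl | hc)
      · exact hb.2.ne
      · exact (hb.2.trans hc.2).ne
    · simp only [Finset.mem_sort, Finset.mem_insert, List.mem_append, List.mem_cons,
        List.mem_filter, decide_eq_true_eq]
      rcases lt_trichotomy b a with h | h | h
      · simp [h, h.ne, h.not_gt]
      · simp [h]
      · simp [h, h.ne', h.not_gt]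

namespace ComputableInPolyTime

variable {ι : Type*} {e : ι → TreeData} {n : ι → ℕ}

theorem sort_insert {a : ι → TreeData} {s : ι → Finset TreeData} (ha : ComputableInPolyTime e a)
    (hs : ComputableInPolyTime e fun i => .ofList (s i).sort) :
    ComputableInPolyTime e fun i => .ofList (insert (a i) (s i)).sort := by
  classical
  refine congr (append (l := fun i => (s i).sort.filter fun b => decide (b < a i))
    (m := fun i => a i :: (s i).sort.filter fun b => decide (a i < b))
    (congr (hs.list_filter (p := fun i b => b < a i) ?_) fun i => ?_)
    (.node ha (congr (hs.list_filter (p := fun i b => a i < b) ?_) fun i => ?_))) fun i => ?_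
  · exact .lt (get hs.weaken vertex) ha.weaken
  · congr!
  · exact .lt ha.weaken (get hs.weaken vertex)
  · congr!
  · rw [Finset.sort_insert_eq_filter]

/-- The sorted list of the values of a function on the indices with a given property. -/
theorem sort_image {p : ∀ i, Fin (n i) → Prop} {c : ∀ i, Fin (n i) → TreeData}
    (hn : ComputableInPolyTime e fun i => ofNat (n i))
    (hp : ComputableInPolyTime (withVertex e n) fun x => ofProp (p x.1 x.2))
    (hc : ComputableInPolyTime (withVertex e n) fun x => c x.1 x.2) :
    ComputableInPolyTime e fun i =>
      .ofList (Set.toFinite (c i '' {v | p i v})).toFinset.sort := by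
  classical
  -- insertion sort; `A i k` is the set of the values at indices not smaller than `k`
  let A : ι → ℕ → Finset TreeData := fun i k =>
    (Set.toFinite (c i '' {v | k ≤ v.1 ∧ p i v})).toFinset
  have hA : ∀ x : Σ i, Fin (n i), A x.1 x.2 =
      if p x.1 x.2 then insert (c x.1 x.2) (A x.1 (x.2 + 1)) else A x.1 (x.2 + 1) := by
    rintro ⟨i, v⟩
    have hv : ∀ w : Fin (n i), v.1 ≤ w.1 ↔ w = v ∨ v.1 + 1 ≤ w.1 := fun w => by
      rw [Fin.ext_iff]; omega
    ext t
    split <;> rename_i h <;>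
      simp only [A, Set.Finite.mem_toFinset, Finset.mem_insert, Set.mem_image,
        Set.mem_ofPred_eq, hv]
    · constructor
      · rintro ⟨w, ⟨rfl | hw, hp⟩, rfl⟩
        · exact .inl rfl
        · exact .inr ⟨w, ⟨hw, hp⟩, rfl⟩
      · rintro (rfl | ⟨w, hw, rfl⟩)
        · exact ⟨v, ⟨.inl rfl, h⟩, rfl⟩
        · exact ⟨w, ⟨.inr hw.1, hw.2⟩, rfl⟩
    · constructor
      · rintro ⟨w, ⟨rfl | hw, hp⟩, rfl⟩
        · exact absurd hp h
        · exact ⟨w, ⟨hw, hp⟩, rfl⟩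
      · rintro ⟨w, hw, rfl⟩
        exact ⟨w, ⟨.inr hw.1, hw.2⟩, rfl⟩
  refine congr (countdown (s := fun i k => .ofList (A i k).sort) hn ?_ ?_ ?_) fun i => ?_
  · refine (const .nil).congr fun i => ?_
    have : A i (n i) = ∅ := by
      ext t
      simp only [A, Set.Finite.mem_toFinset, Set.mem_image, Set.mem_ofPred_eq]
      simp only [Finset.notMem_empty, iff_false]
      rintro ⟨w, ⟨hw, -⟩, -⟩
      exact absurd w.2 (by omega)
    rw [this, Finset.sort_empty]
    rfl
  · refine congr (ite_total (hp.subst id.fst) (sort_insert (hc.subst id.fst) id.snd) id.snd)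
      fun x => ?_
    rw [hA]
    split <;> rfl
  · obtain ⟨q, hq⟩ := hc.polyBounded.trans (e' := fun x : Σ i, Fin (n i) => e x.1) (φ := fun x => x)
      hn.polyBounded_withVertex
    have h₂ : PolyBounded e n := hn.polyBounded.ofNat
    refine (((h₂.mul ((PolyBounded.size.eval q).add (.const 1))).add (.const 1)).reindex
      (fun x : {x : ι × ℕ // x.2 ≤ n x.1} => x.1.1)).mono fun x => ?_
    refine (size_ofList_le (b := q.eval (e x.1.1).size) ?_).trans ?_
    · simp only [Finset.mem_sort, A, Set.Finite.mem_toFinset, Set.mem_image]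
      rintro _ ⟨v, -, rfl⟩
      exact hq ⟨x.1.1, v⟩
    · gcongr
      rw [Finset.length_sort]
      have : A x.1.1 x.1.2 ⊆ Finset.univ.image (c x.1.1) := by
        intro t
        simp only [A, Set.Finite.mem_toFinset, Set.mem_image, Finset.mem_image, Finset.mem_univ,
          true_and]
        rintro ⟨w, -, rfl⟩
        exact ⟨w, rfl⟩
      exact (Finset.card_le_card this).trans (Finset.card_image_le.trans (by simp))
  · simp [A]

end ComputableInPolyTime

/-! ### Isomorphisms and induced subgraphs -/

namespace ColoredGraph

/-- The identity. -/
def Iso.refl (G : ColoredGraph) : G.Iso G := ⟨.refl, fun _ => rfl⟩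

/-- The inverse isomorphism. -/
def Iso.symm {G H : ColoredGraph} (e : G.Iso H) : H.Iso G :=
  ⟨e.toIso.symm, fun v => by rw [← e.map_color, e.toIso.apply_symm_apply]⟩

/-- Composition of isomorphisms. -/
def Iso.trans {G H K : ColoredGraph} (e : G.Iso H) (f : H.Iso K) : G.Iso K :=
  ⟨e.toIso.trans f.toIso, fun v => (f.map_color _).trans (e.map_color v)⟩

theorem Isomorphic.refl (G : ColoredGraph) : G.Isomorphic G := ⟨.refl G⟩

theorem Isomorphic.symm {G H : ColoredGraph} : G.Isomorphic H → H.Isomorphic G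
  | ⟨e⟩ => ⟨e.symm⟩

theorem Isomorphic.trans {G H K : ColoredGraph} :
    G.Isomorphic H → H.Isomorphic K → G.Isomorphic K
  | ⟨e⟩, ⟨f⟩ => ⟨e.trans f⟩

theorem Isomorphic.congr_left {G H K : ColoredGraph} (h : G.Isomorphic H) :
    G.Isomorphic K ↔ H.Isomorphic K :=
  ⟨h.symm.trans, h.trans⟩

theorem Isomorphic.congr_right {G H K : ColoredGraph} (h : H.Isomorphic K) :
    G.Isomorphic H ↔ G.Isomorphic K :=
  ⟨fun h' => h'.trans h, fun h' => h'.trans h.symm⟩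

theorem Isomorphic.inClass {C : GraphClass} (hC : C.Hereditary) {G H : ColoredGraph}
    (h : G.Isomorphic H) (hH : H.InClass C) : G.InClass C :=
  hC _ _ _ _ ⟨h.some.toIso.toEmbedding⟩ hH

theorem InClass.induceRecolored {C : GraphClass} (hC : C.Hereditary) {G : ColoredGraph}
    (hG : G.InClass C) (S : Set G.V) (c : G.V → TreeData) : (G.induceRecolored S c).InClass C :=
  haveI : Finite S := inferInstance
  hC S G.V _ _ ⟨SimpleGraph.Embedding.induce S⟩ hG

/-- An isomorphism maps the subgraph induced by `S` to the one induced by the image of `S`. -/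
theorem Iso.induce_image {G H : ColoredGraph} (e : G.Iso H) (S : Set G.V) :
    (G.induce S).Isomorphic (H.induce (e.toIso '' S)) :=
  ⟨{ toIso := ⟨e.toIso.toEquiv.image S, fun {_ _} => e.toIso.map_adj_iff⟩
     map_color := fun v => e.map_color v.1 }⟩

/-- A subgraph of an induced subgraph is an induced subgraph. -/
theorem induce_induce (G : ColoredGraph) (S : Set G.V) (T : Set S) :
    ((G.induce S).induce T).Isomorphic (G.induce (Subtype.val '' T)) :=
  ⟨{ toIso := ⟨Equiv.Set.image _ T Subtype.val_injective, fun {_ _} => Iff.rfl⟩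
     map_color := fun _ => rfl }⟩

theorem Iso.adj_iff {G H : ColoredGraph} (e : G.Iso H) {v w : G.V} :
    H.graph.Adj (e.toIso v) (e.toIso w) ↔ G.graph.Adj v w :=
  e.toIso.map_adj_iff

theorem Iso.nontrivial_image_iff {G H : ColoredGraph} (e : G.Iso H) (M : Set G.V) :
    H.Nontrivial (e.toIso '' M) ↔ G.Nontrivial M := by
  have hmem : ∀ v, e.toIso v ∈ e.toIso '' M ↔ v ∈ M := fun v =>
    e.toIso.injective.mem_set_image
  constructor
  · rintro ⟨_, ⟨x, hx, rfl⟩, _, ⟨y, hy, rfl⟩, hne, h⟩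
    refine ⟨x, hx, y, hy, fun h' => hne (h' ▸ rfl), fun v hv => ?_⟩
    have := h (e.toIso v) (by rwa [hmem])
    rwa [e.adj_iff, e.adj_iff] at this
  · rintro ⟨x, hx, y, hy, hne, h⟩
    refine ⟨_, ⟨x, hx, rfl⟩, _, ⟨y, hy, rfl⟩, e.toIso.injective.ne hne, fun v hv => ?_⟩
    obtain ⟨u, rfl⟩ := e.toIso.surjective v
    rw [hmem] at hv
    rw [e.adj_iff, e.adj_iff]
    exact h u hv

end ColoredGraph

/-! ### Blocks of a decomposition -/

namespace DecompositionFunctor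

variable {C : GraphClass} (D : DecompositionFunctor C)

theorem Prime.of_isomorphic {D : DecompositionFunctor C} {G H : ColoredGraph} (hG : G.InClass C)
    (hH : H.InClass C) (h : G.Isomorphic H) (hp : D.Prime H) : D.Prime G := by
  obtain ⟨e⟩ := h
  intro M hM hM'
  refine hp (e.toIso '' M) ?_ ((e.nontrivial_image_iff M).2 hM')
  rw [D.invariant G H hG hH e]
  exact ⟨M, hM, rfl⟩

variable {D} {G H : ColoredGraph}

theorem mem_block_self (v : G.V) : v ∈ D.block G v := .inl rfl

theorem block_eq_of_mem_modules (hG : G.InClass C) {M : Set G.V} (hM : M ∈ D.modules G) {v : G.V}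
    (hv : v ∈ M) : D.block G v = M := by
  ext w
  constructor
  · rintro (rfl | ⟨N, hN, hvN, hwN⟩)
    · exact hv
    · rwa [(D.pairwiseDisjoint G hG).elim_set hM hN v hv hvN]
  · exact fun hw => .inr ⟨M, hM, hv, hw⟩

theorem block_eq_of_mem_block (hG : G.InClass C) {v w : G.V} (h : w ∈ D.block G v) :
    D.block G w = D.block G v := by
  rcases h with rfl | ⟨M, hM, hv, hw⟩
  · rfl
  · rw [block_eq_of_mem_modules hG hM hv, block_eq_of_mem_modules hG hM hw]

theorem block_mem_modules (hG : G.InClass C) {v : G.V} (h : G.Nontrivial (D.block G v)) :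
    D.block G v ∈ D.modules G := by
  by_cases hv : ∃ M ∈ D.modules G, v ∈ M
  · obtain ⟨M, hM, hv⟩ := hv
    rwa [block_eq_of_mem_modules hG hM hv]
  · have : ∀ w ∈ D.block G v, w = v := by
      rintro w (rfl | ⟨M, hM, hv', -⟩)
      · rfl
      · exact absurd ⟨M, hM, hv'⟩ hv
    obtain ⟨x, hx, y, hy, hne, -⟩ := h
    exact absurd ((this x hx).trans (this y hy).symm) hne

/-- A block consists of all vertices only in a graph with a single vertex. -/
theorem subsingleton_of_block_eq_univ (hD : D.Proper) (hG : G.InClass C) {v : G.V}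
    (h : D.block G v = Set.univ) : Subsingleton G.V := by
  refine ⟨fun x y => by_contra fun hne => ?_⟩
  have hn : G.Nontrivial (D.block G v) :=
    ⟨x, h ▸ Set.mem_univ x, y, h ▸ Set.mem_univ y, hne, fun u hu => absurd (h ▸ Set.mem_univ u) hu⟩
  exact hD G hG _ (block_mem_modules hG hn) hn h

theorem image_block (hG : G.InClass C) (hH : H.InClass C) (e : G.Iso H) (v : G.V) :
    e.toIso '' D.block G v = D.block H (e.toIso v) := by
  ext u
  obtain ⟨w, rfl⟩ := e.toIso.surjective u
  rw [e.toIso.injective.mem_set_image]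
  simp only [block, D.invariant G H hG hH e, Set.mem_ofPred_eq, Set.mem_image,
    e.toIso.injective.eq_iff]
  constructor
  · rintro (rfl | ⟨M, hM, hv, hw⟩)
    · exact .inl rfl
    · exact .inr ⟨_, ⟨M, hM, rfl⟩, ⟨v, hv, rfl⟩, ⟨w, hw, rfl⟩⟩
  · rintro (rfl | ⟨_, ⟨M, hM, rfl⟩, hv, hw⟩)
    · exact .inl rfl
    · rw [e.toIso.injective.mem_set_image] at hv hw
      exact .inr ⟨M, hM, hv, hw⟩

/-! ### Iterated refinement of an equivalence relation -/

/-- The relation `E` refined by the decompositions of the subgraphs that its classes induce: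
each class of `E` is split into its blocks. -/
def refine (D : DecompositionFunctor C) (G : ColoredGraph) (E : G.V → G.V → Prop) (v w : G.V) :
    Prop :=
  ∃ a b : {u | E v u}, a.1 = v ∧ b.1 = w ∧ b ∈ D.block (G.induce {u | E v u}) a

/-- An equivalence relation whose classes induce graphs in the class `C`. -/
structure Splits (C : GraphClass) (G : ColoredGraph) (E : G.V → G.V → Prop) : Prop where
  equivalence : Equivalence E
  inClass : ∀ v, (G.induce {u | E v u}).InClass C

theorem Splits.setOf_eq {E : G.V → G.V → Prop} (hE : Splits C G E) {v w : G.V} (h : E v w) :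
    {u | E w u} = {u | E v u} :=
  Set.ext fun _ => ⟨hE.equivalence.trans h, hE.equivalence.trans (hE.equivalence.symm h)⟩

theorem Splits.setOf_refine {E : G.V → G.V → Prop} (hE : Splits C G E) (v : G.V) :
    {u | D.refine G E v u} =
      Subtype.val '' D.block (G.induce {u | E v u}) ⟨v, hE.equivalence.refl v⟩ := by
  ext w
  constructor
  · rintro ⟨a, b, ha, rfl, h⟩
    obtain rfl : a = ⟨v, hE.equivalence.refl v⟩ := Subtype.ext ha
    exact ⟨b, h, rfl⟩
  · rintro ⟨b, h, rfl⟩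
    exact ⟨_, b, rfl, rfl, h⟩

/-- The block of `w` in its class, as a set of vertices of `G`. -/
theorem Splits.image_block {E : G.V → G.V → Prop} (hE : Splits C G E) {v : G.V}
    (w : {u | E v u}) :
    Subtype.val '' D.block (G.induce {u | E v u}) w = {u | D.refine G E w.1 u} := by
  obtain ⟨w, hw⟩ := w
  rw [hE.setOf_refine]
  have key : ∀ (S T : Set G.V) (hST : S = T) (hS : w ∈ S) (hT : w ∈ T),
      Subtype.val '' D.block (G.induce S) ⟨w, hS⟩ =
        Subtype.val '' D.block (G.induce T) ⟨w, hT⟩ := by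
    rintro S _ rfl _ _
    rfl
  exact key _ _ (hE.setOf_eq hw).symm _ _

theorem Splits.refine_subset {E : G.V → G.V → Prop} (hE : Splits C G E) (v : G.V) :
    {u | D.refine G E v u} ⊆ {u | E v u} := by
  rw [hE.setOf_refine]
  rintro _ ⟨b, -, rfl⟩
  exact b.2

theorem Splits.refine (hC : C.Hereditary) {E : G.V → G.V → Prop} (hE : Splits C G E) :
    Splits C G (D.refine G E) where
  equivalence := by
    have hrefl : ∀ v, D.refine G E v v := fun v =>
      ⟨⟨v, hE.equivalence.refl v⟩, _, rfl, rfl, mem_block_self _⟩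
    have heq : ∀ {v w}, D.refine G E v w → {u | D.refine G E w u} = {u | D.refine G E v u} := by
      rintro v w ⟨a, b, ha, rfl, h⟩
      have ha' := hE.image_block (D := D) a
      rw [ha] at ha'
      rw [← ha', ← hE.image_block b, block_eq_of_mem_block (hE.inClass _) h]
    refine ⟨hrefl, fun {v w} h => ?_, fun {u v w} h h' => ?_⟩
    · exact (heq h).symm.subset (hrefl v)
    · exact (heq h).subset h'
  inClass v := by
    rw [hE.setOf_refine]
    exact (G.induce_induce _ _).symm.inClass hC ((hE.inClass v).induceRecolored hC _ _)

theorem Splits.iterate (hC : C.Hereditary) {E : G.V → G.V → Prop} (hE : Splits C G E) (k : ℕ) :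
    Splits C G ((D.refine G)^[k] E) := by
  induction k with
  | zero => exact hE
  | succ k ih => rw [Function.iterate_succ_apply']; exact ih.refine hC

/-- As the blocks of a graph with several vertices are proper subsets, the refinement ends in the
identity after at most as many steps as there are vertices. -/
theorem Splits.eq_of_iterate (hC : C.Hereditary) (hD : D.Proper) {E : G.V → G.V → Prop}
    (hE : Splits C G E) {v w : G.V} (h : (D.refine G)^[Nat.card G.V] E v w) : v = w := by
  -- a class with several vertices loses at least one vertex in each round
  have key : ∀ k v, {u | (D.refine G)^[k] E v u}.Subsingleton ∨
      {u | (D.refine G)^[k] E v u}.ncard + k ≤ Nat.card G.V := by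
    intro k v
    induction k with
    | zero => exact .inr (Set.ncard_le_card _)
    | succ k ih =>
      have hk := hE.iterate (D := D) hC k
      rw [Function.iterate_succ_apply']
      have hsub := hk.refine_subset (D := D) v
      rcases ih with ih | ih
      · exact .inl (ih.anti hsub)
      · by_cases heq : {u | D.refine G ((D.refine G)^[k] E) v u} = {u | (D.refine G)^[k] E v u}
        · refine .inl (Set.Subsingleton.anti (Set.subsingleton_coe _ |>.1 ?_) hsub)
          refine subsingleton_of_block_eq_univ hD (hk.inClass v)
            (v := ⟨v, hk.equivalence.refl v⟩) ?_
          rw [hk.setOf_refine] at heq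
          ext u
          simp only [Set.mem_univ, iff_true]
          obtain ⟨u', hu', h⟩ := heq.symm.subset u.2
          rwa [← Subtype.ext h]
        · have := Set.ncard_lt_ncard (hsub.ssubset_of_ne heq) (Set.toFinite _)
          exact .inr (by omega)
  have hk := hE.iterate (D := D) hC (Nat.card G.V)
  rcases key (Nat.card G.V) v with h' | h'
  · exact h' (hk.equivalence.refl v) h
  · have := (Set.ncard_pos (Set.toFinite _)).2
      (⟨v, hk.equivalence.refl v⟩ : {u | (D.refine G)^[Nat.card G.V] E v u}.Nonempty)
    omega

end DecompositionFunctor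

/-! ### Complete invariants with prescribed values -/

theorem TreeData.ofVector_injective {n : ℕ} :
    Function.Injective (ofVector : (Fin n → TreeData) → TreeData) :=
  ofList_injective.comp List.ofFn_injective

theorem TreeData.ofProp_injective : Function.Injective ofProp := fun p q h => by
  unfold ofProp at h
  by_cases hp : p <;> by_cases hq : q <;> simp_all

namespace FinColoredGraph

theorem encode_injective : Function.Injective encode := by
  rintro ⟨n, G, c⟩ ⟨m, H, d⟩ h
  simp only [encode, node.injEq] at h
  obtain ⟨h₁, h₂⟩ := h
  obtain rfl : n = m := by simpa using congrArg List.length (ofList_injective h₂)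
  obtain rfl := ofVector_injective h₂
  have : G = H := by
    ext v w
    have h₃ := congrFun (ofVector_injective (congrFun (ofVector_injective h₁) v)) w
    exact iff_of_eq (ofProp_injective h₃)
  rw [this]

theorem exists_isomorphic (G : ColoredGraph) :
    ∃ F : FinColoredGraph, F.toColoredGraph.Isomorphic G := by
  let φ := (Finite.equivFin G.V).symm
  exact ⟨⟨Nat.card G.V, G.graph.comap φ, fun v => G.color (φ v)⟩,
    ⟨⟨⟨φ, fun {_ _} => Iff.rfl⟩, fun _ => rfl⟩⟩⟩

end FinColoredGraph

/-- The values `val a` are codes of isomorphic copies of the graphs `X a`, and isomorphic graphs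
have the same value. -/
structure IsInvariantOn {α : Type*} (X : α → ColoredGraph) (val : α → TreeData) : Prop where
  exists_encode : ∀ a, ∃ F : FinColoredGraph,
    F.encode = val a ∧ F.toColoredGraph.Isomorphic (X a)
  eq_of_isomorphic : ∀ a b, (X a).Isomorphic (X b) → val a = val b

theorem IsInvariantOn.eq_iff {α : Type*} {X : α → ColoredGraph} {val : α → TreeData}
    (h : IsInvariantOn X val) (a b : α) : val a = val b ↔ (X a).Isomorphic (X b) := by
  refine ⟨fun hab => ?_, h.eq_of_isomorphic a b⟩
  obtain ⟨F, hF, hF'⟩ := h.exists_encode a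
  obtain ⟨F', hF₂, hF₂'⟩ := h.exists_encode b
  obtain rfl : F = F' := FinColoredGraph.encode_injective (by rw [hF, hF₂, hab])
  exact hF'.symm.trans hF₂'

open Classical in
/-- A consistent assignment of values to some graphs extends to a complete invariant: all other
graphs get the code of a fixed isomorphic copy. -/
theorem IsInvariantOn.exists_completeInvariant {α : Type*} {X : α → ColoredGraph}
    {val : α → TreeData} (h : IsInvariantOn X val) (C : GraphClass) :
    ∃ I, IsCompleteInvariant C I ∧ ∀ G a, (X a).Isomorphic G → I G = val a := by
  have : Nonempty FinColoredGraph := ⟨⟨0, ⊥, fun _ => .nil⟩⟩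
  let I : ColoredGraph → TreeData := fun G =>
    if hG : ∃ a, (X a).Isomorphic G then val hG.choose
    else (Classical.epsilon fun F : FinColoredGraph => F.toColoredGraph.Isomorphic G).encode
  have hval : ∀ G a, (X a).Isomorphic G → I G = val a := fun G a ha => by
    have hG : ∃ a, (X a).Isomorphic G := ⟨a, ha⟩
    simp only [I, dif_pos hG]
    exact h.eq_of_isomorphic _ _ (hG.choose_spec.trans ha.symm)
  have hcode : ∀ G, ∃ F : FinColoredGraph, F.encode = I G ∧ F.toColoredGraph.Isomorphic G := by
    intro G
    by_cases hG : ∃ a, (X a).Isomorphic G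
    · obtain ⟨a, ha⟩ := hG
      obtain ⟨F, hF, hF'⟩ := h.exists_encode a
      exact ⟨F, by rw [hF, hval G a ha], hF'.trans ha⟩
    · simp only [I, dif_neg hG]
      exact ⟨_, rfl, Classical.epsilon_spec (FinColoredGraph.exists_isomorphic G)⟩
  refine ⟨I, fun G H _ _ => ⟨fun hGH => ?_, fun hGH => ?_⟩, hval⟩
  · obtain ⟨F, hF, hF'⟩ := hcode G
    obtain ⟨F', hF₂, hF₂'⟩ := hcode H
    obtain rfl : F = F' := FinColoredGraph.encode_injective (by rw [hF, hF₂, hGH])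
    exact hF'.symm.trans hF₂'
  · by_cases hG : ∃ a, (X a).Isomorphic G
    · obtain ⟨a, ha⟩ := hG
      rw [hval G a ha, hval H a (ha.trans hGH)]
    · have hH : ¬ ∃ a, (X a).Isomorphic H := fun ⟨a, ha⟩ => hG ⟨a, ha.trans hGH.symm⟩
      -- `epsilon` is applied to the same predicate for isomorphic graphs
      simp only [I, dif_neg hG, dif_neg hH, hGH.congr_right]

/-! ### Induced subgraphs on an initial segment of the natural numbers -/

namespace FinColoredGraph

/-- The subgraph induced by `S` with new colors `c`, its vertices renumbered in increasing order. -/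
noncomputable def restrict (K : FinColoredGraph) (S : Set (Fin K.n)) (c : Fin K.n → TreeData) :
    FinColoredGraph where
  n := (finFilter (· ∈ S)).length
  graph := K.graph.comap (finFilter (· ∈ S)).get
  color := fun a => c ((finFilter (· ∈ S)).get a)

/-- The vertex of `K` that a vertex of the renumbered subgraph stands for. -/
noncomputable def original (K : FinColoredGraph) (S : Set (Fin K.n)) (c : Fin K.n → TreeData)
    (a : Fin (K.restrict S c).n) : Fin K.n :=
  (finFilter (· ∈ S)).get a

theorem original_mem {K : FinColoredGraph} {S : Set (Fin K.n)} {c : Fin K.n → TreeData}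
    (a : Fin (K.restrict S c).n) : K.original S c a ∈ S :=
  mem_finFilter.1 (List.get_mem _ _)

/-- The renumbered subgraph is isomorphic to the induced subgraph. -/
noncomputable def restrictIso (K : FinColoredGraph) (S : Set (Fin K.n)) (c : Fin K.n → TreeData) :
    (K.restrict S c).toColoredGraph.Iso (K.toColoredGraph.induceRecolored S c) where
  toIso :=
    { toEquiv := Equiv.ofBijective (fun a => (⟨K.original S c a, original_mem a⟩ : S)) <| by
        constructor
        · intro a b h
          exact List.nodup_iff_injective_get.1 (nodup_finFilter _) (Subtype.ext_iff.1 h)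
        · rintro ⟨v, hv⟩
          obtain ⟨a, ha⟩ := List.mem_iff_get.1 (mem_finFilter.2 hv)
          exact ⟨a, Subtype.ext ha⟩
      map_rel_iff' := Iff.rfl }
  map_color _ := rfl

theorem encode_restrict (K : FinColoredGraph) (S : Set (Fin K.n)) (c : Fin K.n → TreeData) :
    (K.restrict S c).encode = .node
      (ofList ((finFilter (· ∈ S)).map fun v =>
        ofList ((finFilter (· ∈ S)).map fun w => ofProp (K.graph.Adj v w))))
      (ofList ((finFilter (· ∈ S)).map c)) := by
  unfold encode
  congr 1
  · rw [← ofVector_get_map]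
    unfold ofRel
    congr 1
    funext a
    exact ofVector_get_map (finFilter (· ∈ S))
      fun w => ofProp (K.graph.Adj ((finFilter (· ∈ S)).get a) w)
  · exact ofVector_get_map (finFilter (· ∈ S)) c

/-- The renumbered subgraph induced by the class of `v`. -/
noncomputable abbrev part (K : FinColoredGraph) (E : Fin K.n → Fin K.n → Prop) (v : Fin K.n) :
    FinColoredGraph :=
  K.restrict {u | E v u} K.color

/-- The renumbered subgraph is isomorphic to the subgraph induced by the class of `v`. -/
noncomputable def partIso (K : FinColoredGraph) (E : Fin K.n → Fin K.n → Prop) (v : Fin K.n) :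
    (K.part E v).toColoredGraph.Iso (K.toColoredGraph.induce {u | E v u}) :=
  K.restrictIso _ _

theorem coe_partIso {K : FinColoredGraph} {E : Fin K.n → Fin K.n → Prop} {v : Fin K.n}
    (a : Fin (K.part E v).n) :
    Subtype.val (p := (· ∈ {u | E v u})) ((K.partIso E v).toIso a) = K.original _ _ a :=
  rfl

theorem part_isomorphic (K : FinColoredGraph) (E : Fin K.n → Fin K.n → Prop) (v : Fin K.n) :
    (K.part E v).toColoredGraph.Isomorphic (K.toColoredGraph.induce {u | E v u}) :=
  ⟨K.partIso E v⟩

end FinColoredGraph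

/-! ### From the blocks of the classes to the classes -/

open FinColoredGraph DecompositionFunctor

section

variable {C : GraphClass} {D : DecompositionFunctor C}

theorem DecompositionFunctor.Splits.part_inClass (hC : C.Hereditary) {K : FinColoredGraph}
    {E : Fin K.n → Fin K.n → Prop} (hE : Splits C K.toColoredGraph E) (v : Fin K.n) :
    (K.part E v).toColoredGraph.InClass C :=
  (K.part_isomorphic E v).inClass hC (hE.inClass v)

/-- The refined relation in terms of the renumbered subgraphs, to which programs can be applied. -/
theorem DecompositionFunctor.refine_iff (hC : C.Hereditary) {K : FinColoredGraph}
    {E : Fin K.n → Fin K.n → Prop} (hE : Splits C K.toColoredGraph E) (v w : Fin K.n) :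
    D.refine K.toColoredGraph E v w ↔ ∃ a b : Fin (K.part E v).n, K.original _ _ a = v ∧
      K.original _ _ b = w ∧ b ∈ D.block (K.part E v).toColoredGraph a := by
  let e := K.partIso E v
  have he : ∀ a b, e.toIso b ∈ D.block (K.toColoredGraph.induce {u | E v u}) (e.toIso a) ↔
      b ∈ D.block (K.part E v).toColoredGraph a := fun a b => by
    rw [← DecompositionFunctor.image_block (hE.part_inClass hC v) (hE.inClass v) e]
    exact e.toIso.injective.mem_set_image
  constructor
  · rintro ⟨a, b, ha, hb, h⟩
    obtain ⟨a, rfl⟩ := e.toIso.surjective a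
    obtain ⟨b, rfl⟩ := e.toIso.surjective b
    exact ⟨a, b, ha, hb, (he a b).1 h⟩
  · rintro ⟨a, b, ha, hb, h⟩
    exact ⟨e.toIso a, e.toIso b, ha, hb, (he a b).2 h⟩

/-- A block of a class induces the same graph in the class as it does, as a class of the refined
relation, in the whole graph. -/
theorem DecompositionFunctor.Splits.induce_block_isomorphic (hC : C.Hereditary)
    {K : FinColoredGraph} {E : Fin K.n → Fin K.n → Prop} (hE : Splits C K.toColoredGraph E)
    (v : Fin K.n) (a : Fin (K.part E v).n) :
    ((K.part E v).toColoredGraph.induce (D.block (K.part E v).toColoredGraph a)).Isomorphic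
      (K.toColoredGraph.induce {u | D.refine K.toColoredGraph E (K.original _ _ a) u}) := by
  let e := K.partIso E v
  have h := e.induce_image (D.block (K.part E v).toColoredGraph a)
  rw [DecompositionFunctor.image_block (hE.part_inClass hC v) (hE.inClass v) e] at h
  refine h.trans ?_
  rw [← coe_partIso, ← hE.image_block (D := D) (e.toIso a)]
  exact K.toColoredGraph.induce_induce _ _

namespace ReplacementOperator

variable (R : ReplacementOperator D)

/-- The quotient graph of `H`, its vertices renumbered, where `val a` takes the place of the
invariant of the block of `a`. -/
noncomputable def finQuotient (H : FinColoredGraph) (val : Fin H.n → TreeData) : FinColoredGraph :=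
  H.restrict (R.remaining H.toColoredGraph) fun a =>
    .node (R.newColor H.toColoredGraph a)
      (.node (typeColors H.toColoredGraph (D.block H.toColoredGraph a) a) (val a))

/-- The renumbered quotient graph of the class of `v`. -/
noncomputable def partQuotient (K : FinColoredGraph) (E : Fin K.n → Fin K.n → Prop)
    (val : Fin K.n → TreeData) (v : Fin K.n) : FinColoredGraph :=
  R.finQuotient (K.part E v) fun a => val (K.original _ _ a)

/-- Each class gets the code of the first class with an isomorphic quotient graph. -/
noncomputable def nextVal (K : FinColoredGraph) (E : Fin K.n → Fin K.n → Prop)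
    (val : Fin K.n → TreeData) (v : Fin K.n) : TreeData :=
  (ofList ((finFilter fun w => (R.partQuotient K E val w).toColoredGraph.Isomorphic
    (R.partQuotient K E val v).toColoredGraph).map fun w => (K.part E w).encode)).left

theorem exists_nextVal (K : FinColoredGraph) (E : Fin K.n → Fin K.n → Prop)
    (val : Fin K.n → TreeData) (v : Fin K.n) :
    ∃ w, (R.partQuotient K E val w).toColoredGraph.Isomorphic
      (R.partQuotient K E val v).toColoredGraph ∧
        R.nextVal K E val v = (K.part E w).encode := by
  unfold nextVal
  generalize hl : (finFilter fun w => (R.partQuotient K E val w).toColoredGraph.Isomorphic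
    (R.partQuotient K E val v).toColoredGraph) = l
  have hmem : ∀ w, w ∈ l ↔ (R.partQuotient K E val w).toColoredGraph.Isomorphic
      (R.partQuotient K E val v).toColoredGraph := fun w => by rw [← hl, mem_finFilter]
  cases l with
  | nil => exact absurd ((hmem v).2 (.refl _)) (by simp)
  | cons w l => exact ⟨w, (hmem w).1 (by simp), rfl⟩

/-- The values obtained from `m` rounds of refinement, computed from the finest partition upwards.
They start with the codes of the classes of the finest partition. -/
noncomputable def classVal (K : FinColoredGraph) :
    ℕ → (Fin K.n → Fin K.n → Prop) → Fin K.n → TreeData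
  | 0, E => fun v => (K.part E v).encode
  | m + 1, E => R.nextVal K E (classVal K m (D.refine K.toColoredGraph E))

/-- All values are codes of induced subgraphs of `K`, so their sizes do not grow from round to
round. -/
theorem exists_classVal (K : FinColoredGraph) (m : ℕ) (E : Fin K.n → Fin K.n → Prop)
    (v : Fin K.n) : ∃ S, R.classVal K m E v = (K.restrict S K.color).encode := by
  cases m with
  | zero => exact ⟨_, rfl⟩
  | succ m => exact (R.exists_nextVal K E _ v).imp' _ fun w hw => hw.2

variable {R} {K : FinColoredGraph} {E : Fin K.n → Fin K.n → Prop} {val : Fin K.n → TreeData}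

/-- Given correct values for the classes of the refined relation, the computed quotients of the
classes of `E` are quotients with respect to a complete invariant. -/
theorem exists_partQuotient_isomorphic (hC : C.Hereditary) (hE : Splits C K.toColoredGraph E)
    (hval : IsInvariantOn
      (fun v => K.toColoredGraph.induce {u | D.refine K.toColoredGraph E v u}) val) :
    ∃ I, IsCompleteInvariant C I ∧ ∀ v, (R.partQuotient K E val v).toColoredGraph.Isomorphic
      (R.quotient I (K.part E v).toColoredGraph) := by
  obtain ⟨I, hI, hI'⟩ := hval.exists_completeInvariant C
  refine ⟨I, hI, fun v => ⟨(restrictIso _ _ _).trans ?_⟩⟩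
  have : ∀ a, val (K.original {u | E v u} K.color a) = I ((K.part E v).toColoredGraph.induce
      (D.block (K.part E v).toColoredGraph a)) := fun a =>
    (hI' _ _ (hE.induce_block_isomorphic hC v a).symm).symm
  simp only [this]
  exact .refl _

theorem partQuotient_inClass (hC : C.Hereditary) (hE : Splits C K.toColoredGraph E) (v : Fin K.n) :
    (R.partQuotient K E val v).toColoredGraph.InClass C :=
  ColoredGraph.Isomorphic.inClass hC ⟨restrictIso _ _ _⟩
    ((hE.part_inClass hC v).induceRecolored hC _ _)

theorem partQuotient_prime (hC : C.Hereditary) (hR : R.Simple) (hE : Splits C K.toColoredGraph E)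
    (hval : IsInvariantOn
      (fun v => K.toColoredGraph.induce {u | D.refine K.toColoredGraph E v u}) val)
    (v : Fin K.n) : D.Prime (R.partQuotient K E val v).toColoredGraph := by
  obtain ⟨I, hI, h⟩ := exists_partQuotient_isomorphic (R := R) hC hE hval
  have hv := hE.part_inClass hC v
  exact .of_isomorphic (partQuotient_inClass hC hE v) (hv.induceRecolored hC _ _) (h v)
    (hR I hI _ hv)

/-- By reversibility, the quotients decide whether the subgraphs induced by two classes are
isomorphic. -/
theorem partQuotient_isomorphic_iff (hC : C.Hereditary) (hR : R.Reversible)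
    (hE : Splits C K.toColoredGraph E)
    (hval : IsInvariantOn
      (fun v => K.toColoredGraph.induce {u | D.refine K.toColoredGraph E v u}) val)
    (v w : Fin K.n) :
    (R.partQuotient K E val v).toColoredGraph.Isomorphic
        (R.partQuotient K E val w).toColoredGraph ↔
      (K.toColoredGraph.induce {u | E v u}).Isomorphic
        (K.toColoredGraph.induce {u | E w u}) := by
  obtain ⟨I, hI, h⟩ := exists_partQuotient_isomorphic (R := R) hC hE hval
  rw [(h v).congr_left, (h w).congr_right,
    ← hR I hI _ _ (hE.part_inClass hC v) (hE.part_inClass hC w),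
    (K.part_isomorphic E v).congr_left, (K.part_isomorphic E w).congr_right]

theorem isInvariantOn_nextVal (hC : C.Hereditary) (hR : R.Reversible)
    (hE : Splits C K.toColoredGraph E)
    (hval : IsInvariantOn
      (fun v => K.toColoredGraph.induce {u | D.refine K.toColoredGraph E v u}) val) :
    IsInvariantOn (fun v => K.toColoredGraph.induce {u | E v u}) (R.nextVal K E val) where
  exists_encode v := by
    obtain ⟨w, hw, h⟩ := R.exists_nextVal K E val v
    exact ⟨_, h.symm, (K.part_isomorphic E w).trans
      ((partQuotient_isomorphic_iff hC hR hE hval w v).1 hw)⟩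
  eq_of_isomorphic v w h := by
    have h' := (partQuotient_isomorphic_iff hC hR hE hval v w).2 h
    simp only [nextVal, h'.congr_right]

/-- Graphs with a single vertex are determined by their codes. -/
theorem isInvariantOn_encode (hE : Splits C K.toColoredGraph E) (h : ∀ v w, E v w → v = w) :
    IsInvariantOn (fun v => K.toColoredGraph.induce {u | E v u})
      fun v => (K.part E v).encode where
  exists_encode v := ⟨_, rfl, K.part_isomorphic E v⟩
  eq_of_isomorphic := by
    rintro v w ⟨e⟩
    have hl : ∀ v, finFilter (· ∈ {u | E v u}) = [v] := fun v => by
      refine List.perm_singleton.1 ((List.perm_ext_iff_of_nodup (nodup_finFilter _)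
        (List.nodup_singleton v)).2 fun u => ?_)
      rw [mem_finFilter, List.mem_singleton]
      exact ⟨fun hu => (h v u hu).symm, fun hu => hu ▸ hE.equivalence.refl _⟩
    have hcolor : K.color w = K.color v := by
      have hv := e.map_color ⟨v, hE.equivalence.refl v⟩
      have hw := h w _ (e.toIso ⟨v, hE.equivalence.refl v⟩).2
      exact (congrArg K.color hw).trans hv
    simp only [encode_restrict, hl]
    simp [hcolor]

/-- The values of the classes of `E` identify the induced subgraphs up to isomorphism. -/
theorem isInvariantOn_classVal (hC : C.Hereditary) (hR : R.Reversible) (m : ℕ)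
    (hE : Splits C K.toColoredGraph E)
    (h : ∀ v w, (D.refine K.toColoredGraph)^[m] E v w → v = w) :
    IsInvariantOn (fun v => K.toColoredGraph.induce {u | E v u}) (R.classVal K m E) := by
  induction m generalizing E with
  | zero => exact isInvariantOn_encode hE h
  | succ m ih => exact isInvariantOn_nextVal hC hR hE (ih (hE.refine hC) h)

end ReplacementOperator

end

/-! ### Polynomial-time computations with graphs -/

namespace ComputableInPolyTime

variable {ι : Type*} {e : ι → TreeData} {K : ι → FinColoredGraph}

theorem card (hK : ComputableInPolyTime e fun i => (K i).encode) :
    ComputableInPolyTime e fun i => ofNat (K i).n :=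
  hK.snd.length.congr fun i => by rw [List.length_ofFn]

theorem adj {v w : ∀ i, Fin (K i).n} (hK : ComputableInPolyTime e fun i => (K i).encode)
    (hv : ComputableInPolyTime e fun i => ofNat (v i))
    (hw : ComputableInPolyTime e fun i => ofNat (w i)) :
    ComputableInPolyTime e fun i => ofProp ((K i).graph.Adj (v i) (w i)) :=
  hK.fst.ofRel_apply hv hw

theorem color {v : ∀ i, Fin (K i).n} (hK : ComputableInPolyTime e fun i => (K i).encode)
    (hv : ComputableInPolyTime e fun i => ofNat (v i)) :
    ComputableInPolyTime e fun i => (K i).color (v i) :=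
  hK.snd.ofVector_apply hv

theorem restrict {S : ∀ i, Set (Fin (K i).n)} {c : ∀ i, Fin (K i).n → TreeData}
    (hK : ComputableInPolyTime e fun i => (K i).encode)
    (hS : ComputableInPolyTime (withVertex e fun i => (K i).n) fun x => ofProp (x.2 ∈ S x.1))
    (hc : ComputableInPolyTime (fun x : {x : Σ i, Fin (K i).n // x.2 ∈ S x.1} =>
      withVertex e (fun i => (K i).n) x.1) fun x => c x.1.1 x.1.2) :
    ComputableInPolyTime e fun i => ((K i).restrict (S i) (c i)).encode := by
  have hadj : ComputableInPolyTime
      (withVertex (withVertex e fun i => (K i).n) fun x => (K x.1).n)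
      fun x => ofProp ((K x.1.1).graph.Adj x.1.2 x.2) :=
    hK.weaken.weaken.adj vertex.weaken vertex
  have hrow : ComputableInPolyTime (withVertex e fun i => (K i).n) fun x =>
      ofList ((finFilter (· ∈ S x.1)).map fun w => ofProp ((K x.1).graph.Adj x.2 w)) := by
    refine finFilter_map (ι := Σ i, Fin (K i).n) (n := fun x => (K x.1).n)
      (p := fun x v => v ∈ S x.1) (f := fun x w => ofProp ((K x.1).graph.Adj x.2 w)) hK.card.weaken ?_ ?_
    · exact hS.subst (φ := fun x : (Σ x : (Σ i, Fin (K i).n), Fin (K x.1).n) => ⟨x.1.1, x.2⟩)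
        (.node id.fst.fst id.snd)
    · exact hadj.reindex Subtype.val
  refine congr (.node (hK.card.finFilter_map (p := fun i v => v ∈ S i)
    (f := fun i v => ofList ((finFilter (· ∈ S i)).map fun w => ofProp ((K i).graph.Adj v w)))
    hS (hrow.reindex Subtype.val)) (hK.card.finFilter_map (p := fun i v => v ∈ S i) hS hc))
    fun i => (encode_restrict _ _ _).symm

theorem original {S : ∀ i, Set (Fin (K i).n)} {c : ∀ i, Fin (K i).n → TreeData}
    {a : ∀ i, Fin ((K i).restrict (S i) (c i)).n}
    (hK : ComputableInPolyTime e fun i => (K i).encode)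
    (hS : ComputableInPolyTime (withVertex e fun i => (K i).n) fun x => ofProp (x.2 ∈ S x.1))
    (ha : ComputableInPolyTime e fun i => ofNat (a i)) :
    ComputableInPolyTime e fun i => ofNat ((K i).original (S i) (c i) (a i)) :=
  (get (l := fun i => (finFilter (· ∈ S i)).map fun v => ofNat v.1)
    (k := fun i => Fin.cast (List.length_map _).symm (a i))
    (hK.card.finFilter_map (p := fun i v => v ∈ S i) (f := fun i v => ofNat v) hS
      (vertex.reindex _)) ha).congr fun i => by
      simp [FinColoredGraph.original]
      rfl

variable {C : GraphClass} {D : DecompositionFunctor C} {R : ReplacementOperator D}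

theorem block {v w : ∀ i, Fin (K i).n} (hD : D.PolyTime)
    (hK : ComputableInPolyTime e fun i => (K i).encode)
    (hv : ComputableInPolyTime e fun i => ofNat (v i))
    (hw : ComputableInPolyTime e fun i => ofNat (w i))
    (hC : ∀ i, (K i).toColoredGraph.InClass C) :
    ComputableInPolyTime e fun i => ofProp (w i ∈ D.block (K i).toColoredGraph (v i)) :=
  (hw.fin_eq hv).or ((hD.subst (φ := fun i => ⟨K i, hC i⟩) hK).ofRel_apply hv hw)

theorem nontrivial_block {v : ∀ i, Fin (K i).n} (hD : D.PolyTime)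
    (hK : ComputableInPolyTime e fun i => (K i).encode)
    (hv : ComputableInPolyTime e fun i => ofNat (v i))
    (hC : ∀ i, (K i).toColoredGraph.InClass C) :
    ComputableInPolyTime e fun i => ofProp
      ((K i).toColoredGraph.Nontrivial (D.block (K i).toColoredGraph (v i))) :=
  hK.card.exists_fin <| .and (block hD hK.weaken hv.weaken vertex fun x => hC x.1) <|
    hK.card.weaken.exists_fin <|
      .and (block hD hK.weaken.weaken hv.weaken.weaken vertex fun x => hC x.1.1) <|
      .and (fin_eq vertex.weaken vertex).not <| hK.card.weaken.weaken.forall_fin <| .imp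
        (block hD hK.weaken.weaken.weaken hv.weaken.weaken.weaken vertex fun x => hC x.1.1.1).not
        (.iff (hK.weaken.weaken.weaken.adj vertex vertex.weaken.weaken)
          (hK.weaken.weaken.weaken.adj vertex vertex.weaken))

theorem typeColors {v : ∀ i, Fin (K i).n} (hD : D.PolyTime)
    (hK : ComputableInPolyTime e fun i => (K i).encode)
    (hv : ComputableInPolyTime e fun i => ofNat (v i))
    (hC : ∀ i, (K i).toColoredGraph.InClass C) :
    ComputableInPolyTime e fun i => ReplacementOperator.typeColors (K i).toColoredGraph
      (D.block (K i).toColoredGraph (v i)) (v i) := by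
  have h := sort_image
    (p := fun i w => w ∈ D.block (K i).toColoredGraph (v i) ∧
      ∀ u, (u ∉ D.block (K i).toColoredGraph (v i) ∧ (K i).graph.Adj w u ↔
        u ∉ D.block (K i).toColoredGraph (v i) ∧ (K i).graph.Adj (v i) u))
    (c := fun i => (K i).color) hK.card
    (.and (block hD hK.weaken hv.weaken vertex fun x => hC x.1) <|
      hK.card.weaken.forall_fin <| .iff
        (.and (block hD hK.weaken.weaken hv.weaken.weaken vertex fun x => hC x.1.1).not
          (hK.weaken.weaken.adj vertex.weaken vertex))
        (.and (block hD hK.weaken.weaken hv.weaken.weaken vertex fun x => hC x.1.1).not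
          (hK.weaken.weaken.adj hv.weaken.weaken vertex)))
    (hK.weaken.color vertex)
  refine h.congr fun i => ?_
  unfold ReplacementOperator.typeColors ColoredGraph.adjType
  simp only [Set.ext_iff, Set.mem_ofPred_eq]

open Classical in
/-- The answer of the replacement operator for the block of `v`. -/
theorem replacement {v : ∀ i, Fin (K i).n} (hD : D.PolyTime) (hR : R.PolyTime)
    (hK : ComputableInPolyTime e fun i => (K i).encode)
    (hv : ComputableInPolyTime e fun i => ofNat (v i))
    (hC : ∀ i, (K i).toColoredGraph.InClass C)
    (hn : ∀ i, (K i).toColoredGraph.Nontrivial (D.block (K i).toColoredGraph (v i))) :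
    ComputableInPolyTime e fun i =>
      if v i ∈ R.keep (K i).toColoredGraph (D.block (K i).toColoredGraph (v i)) then
        .node .nil (R.recolor (K i).toColoredGraph (D.block (K i).toColoredGraph (v i)) (v i))
      else .nil := by
  have h := hR.subst (e' := e) (φ := fun i => ⟨⟨K i, D.block (K i).toColoredGraph (v i)⟩,
    hC i, block_mem_modules (hC i) (hn i), hn i⟩) (.node hK (.tabulate hK.card
      (block hD hK.weaken hv.weaken vertex fun x => hC x.1)))
  exact h.ofVector_apply hv

theorem remaining {v : ∀ i, Fin (K i).n} (hD : D.PolyTime) (hR : R.PolyTime)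
    (hK : ComputableInPolyTime e fun i => (K i).encode)
    (hv : ComputableInPolyTime e fun i => ofNat (v i))
    (hC : ∀ i, (K i).toColoredGraph.InClass C) :
    ComputableInPolyTime e fun i => ofProp (v i ∈ R.remaining (K i).toColoredGraph) :=
  (nontrivial_block hD hK hv hC).imp_of_imp <|
    (replacement (K := fun i : {i // (K i).toColoredGraph.Nontrivial
      (D.block (K i).toColoredGraph (v i))} => K i.1) (v := fun i => v i.1) hD hR (hK.reindex _)
      (hv.reindex _) (fun i => hC i.1) fun i => i.2).ne_nil.congr fun i => by
        congr 1
        simp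

/-- The new colors can be computed for the vertices that remain. For the other ones the program of
the replacement operator outputs no color. -/
theorem newColor {v : ∀ i, Fin (K i).n} (hD : D.PolyTime) (hR : R.PolyTime)
    (hK : ComputableInPolyTime e fun i => (K i).encode)
    (hv : ComputableInPolyTime e fun i => ofNat (v i))
    (hC : ∀ i, (K i).toColoredGraph.InClass C)
    (hr : ∀ i, v i ∈ R.remaining (K i).toColoredGraph) :
    ComputableInPolyTime e fun i => R.newColor (K i).toColoredGraph (v i) :=
  (nontrivial_block hD hK hv hC).ite ((replacement
    (K := fun i : {i // (K i).toColoredGraph.Nontrivial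
      (D.block (K i).toColoredGraph (v i))} => K i.1) (v := fun i => v i.1) hD hR (hK.reindex _)
      (hv.reindex _) (fun i => hC i.1) fun i => i.2).right.congr fun i => by
        rw [if_pos (hr i.1 i.2)]
        rfl) ((hK.color hv).reindex _)

theorem finQuotient {val : ∀ i, Fin (K i).n → TreeData} (hD : D.PolyTime) (hR : R.PolyTime)
    (hK : ComputableInPolyTime e fun i => (K i).encode)
    (hval : ComputableInPolyTime (withVertex e fun i => (K i).n) fun x => val x.1 x.2)
    (hC : ∀ i, (K i).toColoredGraph.InClass C) :
    ComputableInPolyTime e fun i => (R.finQuotient (K i) (val i)).encode :=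
  hK.restrict (remaining hD hR hK.weaken vertex fun x => hC x.1) <|
    .node (newColor (K := fun x : {x : Σ i, Fin (K i).n //
        x.2 ∈ R.remaining (K x.1).toColoredGraph} => K x.1.1) (v := fun x => x.1.2) hD hR
        (hK.weaken.reindex _) (vertex.reindex _) (fun x => hC x.1.1) fun x => x.2)
      (.node ((typeColors hD hK.weaken vertex fun x => hC x.1).reindex _) (hval.reindex _))

end ComputableInPolyTime

/-! ### Computing the values of the classes -/

theorem TreeData.size_ofRel_le {n : ℕ} (r : Fin n → Fin n → Prop) :
    (ofRel r).size ≤ n * (n * 4 + 1 + 1) + 1 :=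
  size_ofVector_le fun _ => size_ofVector_le fun _ => size_ofProp_le _

namespace FinColoredGraph

theorem n_le_size_encode (K : FinColoredGraph) : K.n ≤ K.encode.size := by
  have h := length_le_size_ofList (List.ofFn K.color)
  rw [List.length_ofFn] at h
  refine h.trans ?_
  simp only [encode, size, ofVector]
  omega

/-- The codes of induced subgraphs are polynomially bounded, since they can be computed in
polynomial time from the graph and the membership vector of the vertex set. -/
theorem exists_size_encode_restrict_le : ∃ q : Polynomial ℕ, ∀ (K : FinColoredGraph)
    (S : Set (Fin K.n)), (K.restrict S K.color).encode.size ≤ q.eval K.encode.size := by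
  let e : (Σ K : FinColoredGraph, Set (Fin K.n)) → TreeData := fun x =>
    .node x.1.encode (ofVector fun v => ofProp (v ∈ x.2))
  have hK : ComputableInPolyTime e fun x => x.1.encode := .fst .id
  have hS : ComputableInPolyTime e fun x => ofVector fun v => ofProp (v ∈ x.2) := .snd .id
  have h := hK.restrict (S := fun x => x.2) (c := fun x => x.1.color)
    (hS.weaken.ofVector_apply .vertex) ((hK.weaken.color .vertex).reindex Subtype.val)
  have hn : PolyBounded (fun x : Σ K : FinColoredGraph, Set (Fin K.n) => x.1.encode)
      fun x => x.1.n := PolyBounded.size.mono fun x => x.1.n_le_size_encode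
  obtain ⟨q, hq⟩ := h.polyBounded.trans (φ := fun x => x)
    (((PolyBounded.const 1).add .size).add ((hn.mul (.const 4)).add (.const 1))
      |>.mono fun x => by
        have := size_ofVector_le (f := fun v => ofProp (v ∈ x.2)) fun v => size_ofProp_le _
        simp only [e, size]
        omega)
  exact ⟨q, fun K S => hq ⟨K, S⟩⟩

end FinColoredGraph

namespace ComputableInPolyTime

variable {ι : Type*} {e : ι → TreeData} {K : ι → FinColoredGraph}
  {E : ∀ i, Fin (K i).n → Fin (K i).n → Prop}

theorem part {v : ∀ i, Fin (K i).n} (hK : ComputableInPolyTime e fun i => (K i).encode)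
    (hE : ComputableInPolyTime e fun i => ofRel (E i))
    (hv : ComputableInPolyTime e fun i => ofNat (v i)) :
    ComputableInPolyTime e fun i => ((K i).part (E i) (v i)).encode :=
  hK.restrict (hE.weaken.ofRel_apply hv.weaken vertex) ((hK.weaken.color vertex).reindex _)

theorem part_original {v : ∀ i, Fin (K i).n} {a : ∀ i, Fin ((K i).part (E i) (v i)).n}
    (hK : ComputableInPolyTime e fun i => (K i).encode)
    (hE : ComputableInPolyTime e fun i => ofRel (E i))
    (hv : ComputableInPolyTime e fun i => ofNat (v i))
    (ha : ComputableInPolyTime e fun i => ofNat (a i)) :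
    ComputableInPolyTime e fun i =>
      ofNat ((K i).original {u | E i (v i) u} (K i).color (a i)) :=
  hK.original (hE.weaken.ofRel_apply hv.weaken vertex) ha

variable {C : GraphClass} {D : DecompositionFunctor C} {R : ReplacementOperator D}

theorem refine (hC : C.Hereditary) (hD : D.PolyTime)
    (hK : ComputableInPolyTime e fun i => (K i).encode)
    (hE : ComputableInPolyTime e fun i => ofRel (E i))
    (hs : ∀ i, Splits C (K i).toColoredGraph (E i)) :
    ComputableInPolyTime e fun i => ofRel (n := (K i).n) (D.refine (K i).toColoredGraph (E i)) := by
  refine hK.card.tabulate_rel ?_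
  simp only [fun x : (Σ x : (Σ i, Fin (K i).n), Fin (K x.1).n) =>
    refine_iff (D := D) hC (hs x.1.1) x.1.2 x.2]
  have hP : ComputableInPolyTime (withVertex (withVertex e fun i => (K i).n) fun x => (K x.1).n)
      fun x => ((K x.1.1).part (E x.1.1) x.1.2).encode :=
    part hK.weaken.weaken hE.weaken.weaken vertex.weaken
  refine hP.card.exists_fin (hP.weaken.card.exists_fin (.and ?_ (.and ?_ ?_)))
  · exact .fin_eq (part_original hK.weaken.weaken.weaken.weaken hE.weaken.weaken.weaken.weaken
      vertex.weaken.weaken.weaken vertex.weaken) vertex.weaken.weaken.weaken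
  · exact .fin_eq (part_original hK.weaken.weaken.weaken.weaken hE.weaken.weaken.weaken.weaken
      vertex.weaken.weaken.weaken vertex) vertex.weaken.weaken
  · exact block hD hP.weaken.weaken vertex.weaken vertex fun x => (hs _).part_inClass hC _

theorem refine_iterate {k : ι → ℕ} (hC : C.Hereditary) (hD : D.PolyTime)
    (hK : ComputableInPolyTime e fun i => (K i).encode)
    (hE : ComputableInPolyTime e fun i => ofRel (E i))
    (hk : ComputableInPolyTime e fun i => ofNat (k i))
    (hs : ∀ i, Splits C (K i).toColoredGraph (E i)) :
    ComputableInPolyTime e fun i =>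
      ofRel (n := (K i).n) ((D.refine (K i).toColoredGraph)^[k i] (E i)) := by
  refine congr (fold (l := fun i => List.replicate (k i) .nil)
    (s := fun i j => ofRel (n := (K i).n) ((D.refine (K i).toColoredGraph)^[j] (E i)))
    hk hE ?_ ?_) fun i => ?_
  · simp only [Function.iterate_succ_apply']
    exact refine hC hD (hK.subst id.fst) id.snd.snd fun x => (hs _).iterate hC _
  · have hn : PolyBounded e fun i => (K i).n := hK.card.polyBounded.ofNat
    exact (((hn.mul (((hn.mul (.const 4)).add (.const 1)).add (.const 1))).add
      (.const 1)).reindex _).mono fun x => size_ofRel_le _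
  · rw [List.length_replicate]

theorem partQuotient {val : ∀ i, Fin (K i).n → TreeData} {v : ∀ i, Fin (K i).n}
    (hC : C.Hereditary) (hD : D.PolyTime) (hR : R.PolyTime)
    (hK : ComputableInPolyTime e fun i => (K i).encode)
    (hE : ComputableInPolyTime e fun i => ofRel (E i))
    (hval : ComputableInPolyTime e fun i => ofVector (val i))
    (hv : ComputableInPolyTime e fun i => ofNat (v i))
    (hs : ∀ i, Splits C (K i).toColoredGraph (E i)) :
    ComputableInPolyTime e fun i => (R.partQuotient (K i) (E i) (val i) (v i)).encode :=
  finQuotient hD hR (part hK hE hv)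
    (hval.weaken.ofVector_apply (part_original hK.weaken hE.weaken hv.weaken vertex))
    fun i => (hs i).part_inClass hC (v i)

theorem nextVal {val : ∀ i, Fin (K i).n → TreeData}
    (hC : C.Hereditary) (hD : D.PolyTime) (hR : R.PolyTime) (hsimple : R.Simple)
    (hprime : IsomorphismInPolyTime fun G => G.InClass C ∧ D.Prime G)
    (hK : ComputableInPolyTime e fun i => (K i).encode)
    (hE : ComputableInPolyTime e fun i => ofRel (E i))
    (hval : ComputableInPolyTime e fun i => ofVector (val i))
    (hs : ∀ i, Splits C (K i).toColoredGraph (E i))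
    (hinv : ∀ i, IsInvariantOn (fun v => (K i).toColoredGraph.induce
      {u | D.refine (K i).toColoredGraph (E i) v u}) (val i)) :
    ComputableInPolyTime e fun i => ofVector (R.nextVal (K i) (E i) (val i)) := by
  have hQ : ∀ i v, (R.partQuotient (K i) (E i) (val i) v).toColoredGraph.InClass C ∧
      D.Prime (R.partQuotient (K i) (E i) (val i) v).toColoredGraph := fun i v =>
    ⟨ReplacementOperator.partQuotient_inClass hC (hs i) v,
      ReplacementOperator.partQuotient_prime hC hsimple (hs i) (hinv i) v⟩
  have hiso := hprime.subst
    (e' := withVertex (withVertex e fun i => (K i).n) fun x => (K x.1).n)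
    (φ := fun x => ⟨(R.partQuotient (K x.1.1) (E x.1.1) (val x.1.1) x.2,
      R.partQuotient (K x.1.1) (E x.1.1) (val x.1.1) x.1.2), hQ _ _, hQ _ _⟩)
    (.node (partQuotient hC hD hR hK.weaken.weaken hE.weaken.weaken hval.weaken.weaken vertex
        fun x => hs _)
      (partQuotient hC hD hR hK.weaken.weaken hE.weaken.weaken hval.weaken.weaken vertex.weaken
        fun x => hs _))
  exact hK.card.tabulate (left (finFilter_map (ι := Σ i, Fin (K i).n) (n := fun x => (K x.1).n)
    (p := fun x w => (R.partQuotient (K x.1) (E x.1) (val x.1) w).toColoredGraph.Isomorphic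
      (R.partQuotient (K x.1) (E x.1) (val x.1) x.2).toColoredGraph)
    (f := fun x w => ((K x.1).part (E x.1) w).encode) hK.card.weaken hiso
    ((part hK.weaken.weaken hE.weaken.weaken vertex).reindex Subtype.val)))

/-- The values of the classes of `E` for as many rounds of refinement as there are vertices. The
rounds are processed from the last one to the first one. -/
theorem classVal (hC : C.Hereditary) (hproper : D.Proper) (hD : D.PolyTime) (hR : R.PolyTime)
    (hsimple : R.Simple) (hrev : R.Reversible)
    (hprime : IsomorphismInPolyTime fun G => G.InClass C ∧ D.Prime G)
    (hK : ComputableInPolyTime e fun i => (K i).encode)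
    (hE : ComputableInPolyTime e fun i => ofRel (E i))
    (hs : ∀ i, Splits C (K i).toColoredGraph (E i)) :
    ComputableInPolyTime e fun i => ofVector (R.classVal (K i) (K i).n (E i)) := by
  -- the values of the classes of the `k`-th refinement
  let val : ∀ (i : ι) (k : ℕ), Fin (K i).n → TreeData := fun i k =>
    R.classVal (K i) ((K i).n - k) ((D.refine (K i).toColoredGraph)^[k] (E i))
  have hval : ∀ i k, k < (K i).n → val i k = R.nextVal (K i)
      ((D.refine (K i).toColoredGraph)^[k] (E i)) (val i (k + 1)) := fun i k hk => by
    have : (K i).n - k = (K i).n - (k + 1) + 1 := by omega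
    simp only [val, this, ReplacementOperator.classVal, Function.iterate_succ_apply']
  have hinv : ∀ i k, k ≤ (K i).n → IsInvariantOn (fun v => (K i).toColoredGraph.induce
      {u | (D.refine (K i).toColoredGraph)^[k] (E i) v u}) (val i k) := fun i k hk => by
    refine ReplacementOperator.isInvariantOn_classVal hC hrev _ ((hs i).iterate hC k) ?_
    intro v w h
    rw [← Function.iterate_add_apply, Nat.sub_add_cancel hk] at h
    refine (hs i).eq_of_iterate hC hproper ?_
    rwa [Nat.card_fin]
  refine countdown (s := fun i k => ofVector (val i k)) hK.card ?_ ?_ ?_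
  · refine congr (f := fun i => ofVector fun v =>
      ((K i).part ((D.refine (K i).toColoredGraph)^[(K i).n] (E i)) v).encode) ?_ fun i => ?_
    · exact hK.card.tabulate (part hK.weaken (refine_iterate hC hD hK hE hK.card hs).weaken vertex)
    · simp only [val, Nat.sub_self, ReplacementOperator.classVal]
  · refine congr (nextVal (K := fun x : Σ i, Fin (K i).n => K x.1)
      (E := fun x => (D.refine (K x.1).toColoredGraph)^[x.2] (E x.1))
      (val := fun x => val x.1 (x.2 + 1)) hC hD hR hsimple hprime (hK.subst id.fst.fst) ?_ id.snd
      (fun x => (hs _).iterate hC _) fun x => ?_) fun x => ?_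
    · exact refine_iterate hC hD (hK.subst id.fst.fst) (hE.subst id.fst.fst) id.fst.snd
        fun x => hs _
    · simpa only [Function.iterate_succ_apply'] using hinv x.1 (x.2 + 1) x.2.2
    · rw [hval _ _ x.2.2]
  · obtain ⟨q, hq⟩ := exists_size_encode_restrict_le
    have hn : PolyBounded e fun i => (K i).n := hK.card.polyBounded.ofNat
    refine (((hn.mul ((hK.polyBounded.eval q).add (.const 1))).add (.const 1)).reindex
      (fun x : {x : ι × ℕ // x.2 ≤ (K x.1).n} => x.1.1)).mono fun x => ?_
    refine size_ofVector_le fun v => ?_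
    obtain ⟨S, hS⟩ := R.exists_classVal (K x.1.1) ((K x.1.1).n - x.1.2)
      ((D.refine (K x.1.1).toColoredGraph)^[x.1.2] (E x.1.1)) v
    exact (congrArg size hS).trans_le (hq _ _)

end ComputableInPolyTime

/-! ### Two graphs as the classes of one relation -/

namespace FinColoredGraph

/-- The disjoint union of two graphs; the vertices of `G` come first. -/
def disjointUnion (G H : FinColoredGraph) : FinColoredGraph where
  n := G.n + H.n
  graph :=
    { Adj := fun v w =>
        (∃ a b, v = Fin.castAdd H.n a ∧ w = Fin.castAdd H.n b ∧ G.graph.Adj a b) ∨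
          ∃ a b, v = Fin.natAdd G.n a ∧ w = Fin.natAdd G.n b ∧ H.graph.Adj a b
      symm := ⟨by
        rintro v w (⟨a, b, rfl, rfl, h⟩ | ⟨a, b, rfl, rfl, h⟩)
        · exact .inl ⟨b, a, rfl, rfl, h.symm⟩
        · exact .inr ⟨b, a, rfl, rfl, h.symm⟩⟩
      loopless := ⟨by
        rintro v (⟨a, b, rfl, h, h'⟩ | ⟨a, b, rfl, h, h'⟩)
        · exact h'.ne (Fin.castAdd_injective _ _ h)
        · exact h'.ne (Fin.natAdd_injective _ _ h)⟩ }
  color := Fin.append G.color H.color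

/-- The two vertices of the disjoint union come from the same graph. -/
def SameSide (G H : FinColoredGraph) (v w : Fin (G.disjointUnion H).n) : Prop :=
  (∃ a, v = Fin.castAdd H.n a) ↔ ∃ a, w = Fin.castAdd H.n a

theorem castAdd_ne_natAdd {n m : ℕ} (a : Fin n) (b : Fin m) :
    Fin.castAdd m a ≠ Fin.natAdd n b := fun h => by
  have := congrArg Fin.val h
  simp only [Fin.val_castAdd, Fin.val_natAdd] at this
  omega

variable {G H : FinColoredGraph}

theorem sameSide_castAdd (a : Fin G.n) :
    {u | SameSide G H (Fin.castAdd H.n a) u} = Set.range (Fin.castAdd H.n) := by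
  ext u
  simp only [SameSide, Set.mem_ofPred_eq]
  exact ⟨fun h => (h.1 ⟨a, rfl⟩).imp fun _ => Eq.symm,
    fun ⟨b, hb⟩ => ⟨fun _ => ⟨b, hb.symm⟩, fun _ => ⟨a, rfl⟩⟩⟩

theorem sameSide_natAdd (a : Fin H.n) :
    {u | SameSide G H (Fin.natAdd G.n a) u} = Set.range (Fin.natAdd G.n) := by
  ext u
  have h₁ : ∀ a : Fin H.n, ¬ ∃ b, Fin.natAdd G.n a = Fin.castAdd H.n b :=
    fun a ⟨b, hb⟩ => castAdd_ne_natAdd b a hb.symm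
  simp only [SameSide, Set.mem_ofPred_eq]
  refine Fin.addCases (fun b => ?_) (fun b => ?_) u
  · refine ⟨fun h => absurd (h.2 ⟨b, rfl⟩) (h₁ a), ?_⟩
    rintro ⟨c, hc⟩
    exact absurd hc.symm (castAdd_ne_natAdd b c)
  · exact ⟨fun _ => ⟨b, rfl⟩, fun _ => iff_of_false (h₁ a) (h₁ b)⟩

theorem isomorphic_induce_range (F : FinColoredGraph) (G : ColoredGraph) (f : Fin F.n → G.V)
    (hf : Function.Injective f) (hadj : ∀ a b, G.graph.Adj (f a) (f b) ↔ F.graph.Adj a b)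
    (hcol : ∀ a, G.color (f a) = F.color a) :
    F.toColoredGraph.Isomorphic (G.induce (Set.range f)) :=
  ⟨{ toIso := ⟨Equiv.ofInjective f hf, fun {a b} => hadj a b⟩
     map_color := hcol }⟩

theorem isomorphic_induce_castAdd (a : Fin G.n) : G.toColoredGraph.Isomorphic
    ((G.disjointUnion H).toColoredGraph.induce {u | SameSide G H (Fin.castAdd H.n a) u}) := by
  rw [sameSide_castAdd]
  refine isomorphic_induce_range G _ _ (Fin.castAdd_injective _ _) (fun a b => ?_)
    fun a => Fin.append_left _ _ _
  constructor
  · rintro (⟨c, d, hc, hd, h⟩ | ⟨c, d, hc, -, -⟩)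
    · rwa [Fin.castAdd_injective _ _ hc, Fin.castAdd_injective _ _ hd]
    · exact absurd hc (castAdd_ne_natAdd _ _)
  · exact fun h => .inl ⟨a, b, rfl, rfl, h⟩

theorem isomorphic_induce_natAdd (a : Fin H.n) : H.toColoredGraph.Isomorphic
    ((G.disjointUnion H).toColoredGraph.induce {u | SameSide G H (Fin.natAdd G.n a) u}) := by
  rw [sameSide_natAdd]
  refine isomorphic_induce_range H _ _ (Fin.natAdd_injective _ _) (fun a b => ?_)
    fun a => Fin.append_right _ _ _
  constructor
  · rintro (⟨c, d, hc, -, -⟩ | ⟨c, d, hc, hd, h⟩)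
    · exact absurd hc.symm (castAdd_ne_natAdd _ _)
    · rwa [Fin.natAdd_injective _ _ hc, Fin.natAdd_injective _ _ hd]
  · exact fun h => .inr ⟨a, b, rfl, rfl, h⟩

theorem splits_sameSide {C : GraphClass} (hC : C.Hereditary) (hG : G.toColoredGraph.InClass C)
    (hH : H.toColoredGraph.InClass C) :
    Splits C (G.disjointUnion H).toColoredGraph (SameSide G H) where
  equivalence := ⟨fun _ => Iff.rfl, Iff.symm, Iff.trans⟩
  inClass v := by
    refine Fin.addCases (fun a => ?_) (fun a => ?_) v
    · exact (isomorphic_induce_castAdd a).symm.inClass hC hG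
    · exact (isomorphic_induce_natAdd a).symm.inClass hC hH

/-- Two graphs are isomorphic if both are empty or if their values as the classes of the disjoint
union agree. -/
theorem isomorphic_iff_of_isInvariantOn {val : Fin (G.disjointUnion H).n → TreeData}
    (h : IsInvariantOn
      (fun v => (G.disjointUnion H).toColoredGraph.induce {u | SameSide G H v u}) val) :
    G.toColoredGraph.Isomorphic H.toColoredGraph ↔ (G.n = 0 ∧ H.n = 0) ∨
      ∃ a b, val (Fin.castAdd H.n a) = val (Fin.natAdd G.n b) := by
  have key : ∀ a b, val (Fin.castAdd H.n a) = val (Fin.natAdd G.n b) ↔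
      G.toColoredGraph.Isomorphic H.toColoredGraph := fun a b => by
    refine (h.eq_iff _ _).trans ?_
    rw [← (isomorphic_induce_castAdd (H := H) a).congr_left,
      ← (isomorphic_induce_natAdd (G := G) b).congr_right]
  constructor
  · intro hiso
    have hn : G.n = H.n := Fin.equiv_iff_eq.1 ⟨hiso.some.toIso.toEquiv⟩
    rcases Nat.eq_zero_or_pos G.n with h0 | h0
    · exact .inl ⟨h0, hn ▸ h0⟩
    · exact .inr ⟨⟨0, h0⟩, ⟨0, hn ▸ h0⟩, (key _ _).2 hiso⟩
  · rintro (⟨hG, hH⟩ | ⟨a, b, hab⟩)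
    · have : IsEmpty (Fin G.n) := hG ▸ Fin.isEmpty
      have : IsEmpty (Fin H.n) := hH ▸ Fin.isEmpty
      exact ⟨⟨⟨Equiv.equivOfIsEmpty _ _, fun {a} => isEmptyElim a⟩, fun a => isEmptyElim a⟩⟩
    · exact (key a b).1 hab

end FinColoredGraph

namespace ComputableInPolyTime

variable {ι : Type*} {e : ι → TreeData} {G H : ι → FinColoredGraph}

theorem disjointUnion (hG : ComputableInPolyTime e fun i => (G i).encode)
    (hH : ComputableInPolyTime e fun i => (H i).encode) :
    ComputableInPolyTime e fun i => ((G i).disjointUnion (H i)).encode := by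
  have hn : ComputableInPolyTime e fun i => ofNat ((G i).n + (H i).n) := hG.card.ofNat_add hH.card
  refine .node (.tabulate_rel hn (.or ?_ ?_)) ?_
  · refine hG.weaken.weaken.card.exists_fin (hG.weaken.weaken.weaken.card.exists_fin
      (.and ?_ (.and ?_ (hG.weaken.weaken.weaken.weaken.adj vertex.weaken vertex))))
    · exact fin_eq vertex.weaken.weaken.weaken vertex.weaken
    · exact fin_eq vertex.weaken.weaken vertex
  · refine hH.weaken.weaken.card.exists_fin (hH.weaken.weaken.weaken.card.exists_fin
      (.and ?_ (.and ?_ (hH.weaken.weaken.weaken.weaken.adj vertex.weaken vertex))))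
    · exact fin_eq vertex.weaken.weaken.weaken
        (ofNat_add hG.card.weaken.weaken.weaken.weaken vertex.weaken)
    · exact fin_eq vertex.weaken.weaken (ofNat_add hG.card.weaken.weaken.weaken.weaken vertex)
  · refine congr (append hG.snd hH.snd) fun i => ?_
    rw [← List.ofFn_fin_append]
    rfl

theorem sameSide (hG : ComputableInPolyTime e fun i => (G i).encode)
    (hH : ComputableInPolyTime e fun i => (H i).encode) :
    ComputableInPolyTime e fun i => ofRel (SameSide (G i) (H i)) :=
  .tabulate_rel (disjointUnion hG hH).card <| .iff
    (hG.weaken.weaken.card.exists_fin (fin_eq vertex.weaken.weaken vertex))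
    (hG.weaken.weaken.card.exists_fin (fin_eq vertex.weaken vertex))

end ComputableInPolyTime

theorem mainTheorem3 (C : GraphClass) (hC : C.Hereditary)
    (D : DecompositionFunctor C) (hDproper : D.Proper) (hD : D.PolyTime)
    (R : ReplacementOperator D) (hR : R.PolyTime)
    (hsimple : R.Simple) (hrev : R.Reversible)
    (hprime : IsomorphismInPolyTime fun G => G.InClass C ∧ D.Prime G) :
    IsomorphismInPolyTime fun G => G.InClass C := by
  let ι := {x : FinColoredGraph × FinColoredGraph //
    x.1.toColoredGraph.InClass C ∧ x.2.toColoredGraph.InClass C}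
  let e : ι → TreeData := fun x => .node x.1.1.encode x.1.2.encode
  have hG : ComputableInPolyTime e fun x => x.1.1.encode := .fst .id
  have hH : ComputableInPolyTime e fun x => x.1.2.encode := .snd .id
  have hs : ∀ x : ι, Splits C (x.1.1.disjointUnion x.1.2).toColoredGraph
      (SameSide x.1.1 x.1.2) := fun x => splits_sameSide hC x.2.1 x.2.2
  let val : ∀ x : ι, Fin (x.1.1.disjointUnion x.1.2).n → TreeData := fun x =>
    R.classVal (x.1.1.disjointUnion x.1.2) (x.1.1.disjointUnion x.1.2).n (SameSide x.1.1 x.1.2)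
  have hval : ComputableInPolyTime e fun x => ofVector (val x) :=
    .classVal hC hDproper hD hR hsimple hrev hprime (hG.disjointUnion hH) (hG.sameSide hH) hs
  have hinv := fun x : ι => ReplacementOperator.isInvariantOn_classVal (R := R) hC hrev
    (x.1.1.disjointUnion x.1.2).n (hs x) fun v w h =>
      (hs x).eq_of_iterate hC hDproper (by rwa [Nat.card_fin])
  have hex : ComputableInPolyTime e fun x =>
      ofProp (∃ a b, val x (Fin.castAdd _ a) = val x (Fin.natAdd _ b)) := by
    have hval' : ComputableInPolyTime
        (withVertex (withVertex e fun x => x.1.1.n) fun x => x.1.1.2.n)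
        fun x => ofVector (val x.1.1) := hval.weaken.weaken
    refine hG.card.exists_fin (hH.weaken.card.exists_fin (.eq ?_ ?_))
    · exact hval'.ofVector_apply (v := fun x => Fin.castAdd _ x.1.2) (.weaken .vertex)
    · exact hval'.ofVector_apply (v := fun x => Fin.natAdd _ x.2)
        (.ofNat_add hG.card.weaken.weaken .vertex)
  exact (ComputableInPolyTime.or (.and (.nat_eq hG.card .ofNat_zero)
    (.nat_eq hH.card .ofNat_zero)) hex).congr fun x =>
      congrArg ofProp (propext (isomorphic_iff_of_isInvariantOn (hinv x)).symm)
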